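/- **Theorem.** Let $S$ be a finite set, let $Q$ be an integral matrix whose columns are indexed by $S$ and which has finitely many rows, and let $p$ be an integral vector indexed by the rows of $Q$. Recall that a rational linear system $Ax\ge b$ is *totally dual integral* (TDI) if, for every integral vector $d$ for which $\max\{yb : y\ge 0,\ yA=d\}$ is finite, this maximum has an integral optimal solution $y$; and that $Ax\ge b$ is *box-TDI* if the system $[Ax\ge b,\ f\le x\le g]$ is TDI for all rational vectors $f\le g$. Suppose that the system $Qx\ge p$ is box-TDI and that the polyhedron $R:=\{x\in\mathbf R^S : Qx\ge p\}$ is non-empty. Let $R_{\mathbf Z}:=R\cap\mathbf Z^S$ and let $c\in\mathbf Z^S$ be a vector with $c(s)>0$ for all $s\in S$. (a) Both of the following optima are attained, and $$\min\Big\{\sum_{s\in S}c(s)z(s)^2 : z\in R_{\mathbf Z}\Big\}=\max\Big\{yp-\sum_{s\in S}\Big\lfloor\frac{w(s)+c(s)}{2c(s)}\Big\rfloor\Big(w(s)-c(s)\Big\lfloor\frac{w(s)+c(s)}{2c(s)}\Big\rfloor\Big) : w=yQ,\ y\ge 0\text{ integral}\Big\}.$$ (b) An element $z^*\in R_{\mathbf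 Z}$ attains the minimum if and only if there is an integral vector $y^*\ge 0$ such that, with $w^*:=y^*Q$, $$y^*(Qz^*-p)=0\quad\text{and}\quad c(s)\,(2z^*(s)-1)\le w^*(s)\le c(s)\,(2z^*(s)+1)\ \text{ for every } s\in S.$$ (c) Let $E$ be the set of (indices of) nonzero rows $q_i$ of $Q$ for which $q_ix=p_i$ holds for all $x\in R$. If $|E|\le 2\operatorname{rank}\{q_i : i\in E\}$ (in particular if $R$ is full-dimensional, when $E=\emptyset$), then the maximum in (a) is attained by some integral $y^*\ge 0$ with at most $2|S|$ positive components. -/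

import Mathlib

open Matrix

namespace BoxTDI

/-- The polyhedron `{x : A x ≥ b}` in `ℝ^S`. -/
def polyhedron {ι S : Type*} [Fintype S] (A : Matrix ι S ℝ) (b : ι → ℝ) : Set (S → ℝ) :=
  {x | b ≤ A *ᵥ x}

/-- The set of integral elements of `R ⊆ ℝ^S`. -/
def integralPoints {S : Type*} (R : Set (S → ℝ)) : Set (S → ℤ) :=
  {z | (fun s => (z s : ℝ)) ∈ R}

/-- The feasible set `{y : y ≥ 0, y A = c}` of the linear program dual to `min {c x : A x ≥ b}`. -/
def dualFeasible {ι S : Type*} [Fintype ι] (A : Matrix ι S ℝ) (c : S → ℝ) : Set (ι → ℝ) :=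
  {y | 0 ≤ y ∧ y ᵥ* A = c}

/-- The (rational) system `A x ≥ b` is totally dual integral: for every integral `c` for which
`max {y b : y ≥ 0, y A = c}` is finite (some real `y` is feasible and the objective is bounded
above), this maximum has an integral optimal solution. -/
def IsTDI {ι S : Type*} [Fintype ι] (A : Matrix ι S ℝ) (b : ι → ℝ) : Prop :=
  ∀ c : S → ℤ,
    (dualFeasible A (fun s => (c s : ℝ))).Nonempty →
    BddAbove ((fun y => y ⬝ᵥ b) '' dualFeasible A (fun s => (c s : ℝ))) →
    ∃ y : ι → ℤ,
      (fun i => (y i : ℝ)) ∈ dualFeasible A (fun s => (c s : ℝ)) ∧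
      ∀ y' ∈ dualFeasible A (fun s => (c s : ℝ)), y' ⬝ᵥ b ≤ (fun i => (y i : ℝ)) ⬝ᵥ b

/-- The (rational) system `A x ≥ b` is box-totally dual integral: the system
`A x ≥ b, x ≥ f, -x ≥ -g` is TDI for every choice of rational vectors `f ≤ g`. -/
def IsBoxTDI {ι S : Type*} [Fintype ι] [Fintype S] [DecidableEq S]
    (A : Matrix ι S ℝ) (b : ι → ℝ) : Prop :=
  ∀ f g : S → ℚ, f ≤ g →
    IsTDI (fromRows A (fromRows (1 : Matrix S S ℝ) (-1 : Matrix S S ℝ)))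
      (Sum.elim b (Sum.elim (fun s => (f s : ℝ)) (fun s => -(g s : ℝ))))

/-- The weighted square-sum `∑ c(s) z(s)²`. -/
def weightedSquareSum {S : Type*} [Fintype S] (c z : S → ℤ) : ℤ :=
  ∑ s, c s * z s ^ 2

/-- The dual objective
`y p - ∑ ⌊(w(s) + c(s)) / (2 c(s))⌋ (w(s) - c(s) ⌊(w(s) + c(s)) / (2 c(s))⌋)`, where `w = y Q`. -/
noncomputable def dualObjective {ι S : Type*} [Fintype ι] [Fintype S]
    (Q : Matrix ι S ℤ) (p : ι → ℤ) (c : S → ℤ) (y : ι → ℤ) : ℤ :=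
  y ⬝ᵥ p - ∑ s,
    ⌊(((y ᵥ* Q) s + c s : ℤ) : ℝ) / (2 * (c s : ℝ))⌋ *
      ((y ᵥ* Q) s - c s * ⌊(((y ᵥ* Q) s + c s : ℤ) : ℝ) / (2 * (c s : ℝ))⌋)

/-- The implicit equations of `A x ≥ b`: the indices of the nonzero rows of `A` whose inequality
holds with equality throughout the polyhedron. There are none if the polyhedron is
full-dimensional. -/
def implicitEquations {ι S : Type*} [Fintype S] (A : Matrix ι S ℝ) (b : ι → ℝ) : Set ι :=
  {i | A i ≠ 0 ∧ ∀ x ∈ polyhedron A b, (A *ᵥ x) i = b i}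

end BoxTDI

open scoped Topology

namespace BoxTDI

/-! For `y ≥ 0`, `w = yQ` and `z` feasible, `yp = wz - y(Qz - p)`, and on the integers the concave
function `k ↦ k (w(s) - c(s) k)` is maximal at the integers nearest to `w(s) / (2c(s))`, one of
which is the floor in the dual objective. This gives weak duality. Equality holds if the slack term
vanishes and every `z(s)` is such a nearest integer, which is the criterion in (b). So (a) and (b)
reduce to the necessity of that criterion at a minimizer `z`: the cone of the rows tight at `z` must
contain an integral combination in the box `[c(2z - 1), c(2z + 1)]`.

If the cone missed the box, Farkas' lemma would give a feasible direction along which the linear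
objective `d`, made of the marginal costs of unit steps, decreases. Box-TDI-ness turns a short move
in this direction into an integral feasible point at distance at most one in each coordinate. There
`d` measures the change of the square-sum exactly, so `z` was not minimal
(`IsBoxTDI.exists_multiplier_of_isMinOn`). A real cone point in the box is then made integral by
walking towards integral cone points (`IsBoxTDI.exists_integral_between`).

For (c), let `L` be the span of the implicit equations. Modulo `L` the tight cone is pointed, so `w`
has a real representation of largest coefficient sum that uses at most `codim L` rows. Round it down
and represent the integral remainder integrally: by maximality the remainder has coefficient sum at
most `codim L` outside `E`. Together with `|E| ≤ 2 dim L` this bounds the support by `2|S|`. -/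

/-! ### Farkas' lemma and linear programming duality. -/

/-- **Farkas' lemma** for the rows of a matrix indexed by a finset. -/
theorem farkas_finset {κ σ : Type*} [Fintype σ] (t : Finset κ) :
    ∀ (a : κ → σ → ℝ) (b : σ → ℝ), (∀ x, (∀ i ∈ t, 0 ≤ a i ⬝ᵥ x) → 0 ≤ b ⬝ᵥ x) →
      ∃ y : κ → ℝ, (∀ i, 0 ≤ y i) ∧ (∀ i ∉ t, y i = 0) ∧ ∑ i ∈ t, y i • a i = b := by
  classical
  induction t using Finset.induction_on with
  | empty =>
    intro a b h
    refine ⟨0, fun _ => le_rfl, fun _ _ => rfl, ?_⟩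
    have h1 := h (-b) (by simp)
    have h2 : b ⬝ᵥ b = 0 := by
      have h3 : 0 ≤ b ⬝ᵥ b := Finset.sum_nonneg fun i _ => mul_self_nonneg _
      rw [dotProduct_neg] at h1
      linarith
    simpa using (dotProduct_self_eq_zero.mp h2).symm
  | insert k t hk ih =>
    intro a b h
    by_cases hb : ∀ x, (∀ i ∈ t, 0 ≤ a i ⬝ᵥ x) → 0 ≤ b ⬝ᵥ x
    · obtain ⟨y, hy0, hyt, hy⟩ := ih a b hb
      refine ⟨y, hy0, fun i hi => hyt i fun hit => hi (Finset.mem_insert_of_mem hit), ?_⟩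
      rw [Finset.sum_insert hk, hyt k hk, hy]
      simp
    · push Not at hb
      obtain ⟨x₁, hx₁, hbx₁⟩ := hb
      have hkx₁ : a k ⬝ᵥ x₁ < 0 := by
        by_contra hcon
        exact absurd (h x₁ (by
          intro i hi
          rcases Finset.mem_insert.mp hi with rfl | hi
          · exact not_lt.mp hcon
          · exact hx₁ i hi)) (not_le.mpr hbx₁)
      obtain ⟨x₀, hx₀, hbx₀, hkx₀⟩ :
          ∃ x₀, (∀ i ∈ t, 0 ≤ a i ⬝ᵥ x₀) ∧ b ⬝ᵥ x₀ < 0 ∧ a k ⬝ᵥ x₀ = -1 := by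
        have hpos : 0 < (-(a k ⬝ᵥ x₁))⁻¹ := inv_pos.mpr (by linarith)
        refine ⟨(-(a k ⬝ᵥ x₁))⁻¹ • x₁, fun i hi => ?_, ?_, ?_⟩
        · rw [dotProduct_smul]
          exact mul_nonneg hpos.le (hx₁ i hi)
        · rw [dotProduct_smul]
          exact mul_neg_of_pos_of_neg hpos hbx₁
        · rw [dotProduct_smul, smul_eq_mul]
          rw [inv_neg, neg_mul, inv_mul_cancel₀ hkx₁.ne]
      -- Project along `a k` onto the hyperplane orthogonal to `x₀`. The projected hypothesis at `x`
      -- is the original one at `x + (a k ⬝ᵥ x) • x₀`, which is orthogonal to `a k`.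
      obtain ⟨y, hy0, hyt, hy⟩ := ih (fun i => a i + (a i ⬝ᵥ x₀) • a k)
        (b + (b ⬝ᵥ x₀) • a k) (by
          intro x hx
          have := h (x + (a k ⬝ᵥ x) • x₀) (by
            intro i hi
            rcases Finset.mem_insert.mp hi with rfl | hi
            · simp [dotProduct_add, dotProduct_smul, hkx₀]
            · have := hx i hi
              simp only [add_dotProduct, smul_dotProduct, dotProduct_add, dotProduct_smul,
                smul_eq_mul] at this ⊢
              linarith)
          simp only [add_dotProduct, smul_dotProduct, dotProduct_add, dotProduct_smul,
            smul_eq_mul] at this ⊢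
          linarith)
      refine ⟨Function.update y k (∑ i ∈ t, y i * (a i ⬝ᵥ x₀) - b ⬝ᵥ x₀), ?_, ?_, ?_⟩
      · intro i
        rcases eq_or_ne i k with rfl | hik
        · rw [Function.update_self]
          have : 0 ≤ ∑ j ∈ t, y j * (a j ⬝ᵥ x₀) :=
            Finset.sum_nonneg fun j hj => mul_nonneg (hy0 j) (hx₀ j hj)
          linarith
        · rw [Function.update_of_ne hik]
          exact hy0 i
      · intro i hi
        rw [Finset.mem_insert, not_or] at hi
        rw [Function.update_of_ne hi.1]
        exact hyt i hi.2
      · rw [Finset.sum_insert hk, Function.update_self]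
        have hsum : ∑ i ∈ t, Function.update y k (∑ i ∈ t, y i * (a i ⬝ᵥ x₀) - b ⬝ᵥ x₀) i • a i
            = ∑ i ∈ t, y i • a i := by
          refine Finset.sum_congr rfl fun i hi => ?_
          rw [Function.update_of_ne (ne_of_mem_of_not_mem hi hk)]
        rw [hsum]
        simp only [smul_add, Finset.sum_add_distrib, smul_smul, ← Finset.sum_smul] at hy
        rw [sub_smul, sub_add_eq_add_sub, add_comm, hy, add_sub_cancel_right]

/-- Strong duality for linear programs with a feasible, bounded primal. -/
theorem exists_dualFeasible_of_forall_le {κ S : Type*} [Fintype κ] [Fintype S]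
    {A : Matrix κ S ℝ} {b : κ → ℝ} {d : S → ℝ} {m : ℝ} (hne : (polyhedron A b).Nonempty)
    (h : ∀ x ∈ polyhedron A b, m ≤ d ⬝ᵥ x) :
    ∃ y ∈ dualFeasible A d, m ≤ y ⬝ᵥ b := by
  classical
  obtain ⟨x₀, hx₀⟩ := hne
  -- Homogenization: the target `(d, m)` lies in the cone of the `(A k, b k)` and `(0, -1)`. In a
  -- test vector `(x, -t)`, `t > 0` rescales to a feasible point and `t = 0` gives a recession
  -- direction.
  obtain ⟨y, hy0, -, hy⟩ := farkas_finset (Finset.univ : Finset (Option κ))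
    (fun k => k.elim (Sum.elim (0 : S → ℝ) fun _ : Unit => (-1 : ℝ))
      fun k => Sum.elim (A k) fun _ => b k)
    (Sum.elim d fun _ => m) (by
      intro x hx
      obtain ⟨x, t, rfl⟩ : ∃ (x' : S → ℝ) (t : ℝ), x = Sum.elim x' fun _ => -t :=
        ⟨x ∘ Sum.inl, -x (Sum.inr ()), by ext (_ | _) <;> simp⟩
      have hdp : ∀ (v : S → ℝ) (r : ℝ), (Sum.elim v fun _ : Unit => r) ⬝ᵥ
          (Sum.elim x fun _ : Unit => -t) = v ⬝ᵥ x - r * t := by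
        intro v r
        simp [dotProduct, Fintype.sum_sum_type, sub_eq_add_neg]
      have ht : 0 ≤ t := by
        have := hx none (Finset.mem_univ _)
        simp only [Option.elim, hdp] at this
        simpa using this
      have hA : ∀ k, b k * t ≤ A k ⬝ᵥ x := by
        intro k
        have := hx (some k) (Finset.mem_univ _)
        simp only [Option.elim, hdp] at this
        linarith
      rw [hdp]
      rcases ht.eq_or_lt with rfl | ht
      · by_contra hneg
        simp only [mul_zero, sub_zero, not_le] at hneg
        -- Chosen so that the objective at `x₀ + r • x` is `m - 1`.
        set r := (d ⬝ᵥ x₀ - m + 1) / (-(d ⬝ᵥ x)) with hr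
        have hr0 : 0 ≤ r := div_nonneg (by linarith [h x₀ hx₀]) (by linarith)
        have h1 := h (x₀ + r • x) (by
          intro k
          have h2 := hx₀ k
          have h3 := hA k
          rw [mul_zero] at h3
          rw [mulVec_add, mulVec_smul]
          have h4 : 0 ≤ r * (A k ⬝ᵥ x) := mul_nonneg hr0 h3
          simp only [Pi.add_apply, Pi.smul_apply, smul_eq_mul]
          change b k ≤ (A *ᵥ x₀) k + r * (A k ⬝ᵥ x)
          linarith)
        rw [dotProduct_add, dotProduct_smul, smul_eq_mul] at h1
        have h5 : r * (d ⬝ᵥ x) = -(d ⬝ᵥ x₀ - m + 1) := by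
          rw [hr, div_neg, neg_mul, div_mul_cancel₀ _ hneg.ne]
        linarith
      · have h1 := h (t⁻¹ • x) (by
          intro k
          rw [mulVec_smul]
          change b k ≤ t⁻¹ * (A k ⬝ᵥ x)
          rw [inv_mul_eq_div, le_div_iff₀ ht]
          exact hA k)
        rw [dotProduct_smul, smul_eq_mul, inv_mul_eq_div, le_div_iff₀ ht] at h1
        linarith)
  refine ⟨fun k => y (some k), ⟨fun k => hy0 _, ?_⟩, ?_⟩
  · ext s
    have := congrFun hy (Sum.inl s)
    simp only [Fintype.sum_option, Finset.sum_apply, Pi.smul_apply, Option.elim,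
      Sum.elim_inl, smul_eq_mul] at this
    simpa [vecMul, dotProduct] using this
  · have := congrFun hy (Sum.inr ())
    simp only [Fintype.sum_option, Finset.sum_apply, Pi.smul_apply, Option.elim,
      Sum.elim_inr, smul_eq_mul] at this
    have h0 := hy0 none
    simp only [dotProduct]
    linarith

theorem dualFeasible_dotProduct_eq {ι S : Type*} [Fintype ι] [Fintype S] {A : Matrix ι S ℝ}
    {d : S → ℝ} {y : ι → ℝ} (hy : y ∈ dualFeasible A d) (b : ι → ℝ) (x : S → ℝ) :
    y ⬝ᵥ b = d ⬝ᵥ x - y ⬝ᵥ (A *ᵥ x - b) := by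
  rw [dotProduct_sub, dotProduct_mulVec, hy.2]
  ring

/-- Weak duality for linear programs. -/
theorem dualFeasible_dotProduct_le {ι S : Type*} [Fintype ι] [Fintype S] {A : Matrix ι S ℝ}
    {b : ι → ℝ} {d : S → ℝ} {y : ι → ℝ} (hy : y ∈ dualFeasible A d) {x : S → ℝ}
    (hx : x ∈ polyhedron A b) : y ⬝ᵥ b ≤ d ⬝ᵥ x := by
  rw [dualFeasible_dotProduct_eq hy b x, sub_le_self_iff]
  exact Finset.sum_nonneg fun i _ => mul_nonneg (hy.1 i) (sub_nonneg.mpr (hx i))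

theorem bddAbove_dualFeasible {ι S : Type*} [Fintype ι] [Fintype S] {A : Matrix ι S ℝ}
    {b : ι → ℝ} {x : S → ℝ} (hx : x ∈ polyhedron A b) (d : S → ℝ) :
    BddAbove ((fun y => y ⬝ᵥ b) '' dualFeasible A d) :=
  ⟨d ⬝ᵥ x, by
    rintro _ ⟨y, hy, rfl⟩
    exact dualFeasible_dotProduct_le hy hx⟩

/-! ### Integrality in TDI systems. -/

/-- In a TDI system, an integral vector in the cone of the rows that are tight at a feasible point
is a nonnegative integral combination of these rows. -/
theorem IsTDI.exists_integral_slack {ι S : Type*} [Fintype ι] [Fintype S] {A : Matrix ι S ℝ}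
    {b : ι → ℝ} (h : IsTDI A b) {x : S → ℝ} (hx : x ∈ polyhedron A b) {d : S → ℤ} {y : ι → ℝ}
    (hy : y ∈ dualFeasible A fun s => (d s : ℝ)) (hslack : ∀ i, y i ≠ 0 → (A *ᵥ x) i = b i) :
    ∃ y' : ι → ℤ, (fun i => (y' i : ℝ)) ∈ dualFeasible A (fun s => (d s : ℝ)) ∧
      ∀ i, y' i ≠ 0 → (A *ᵥ x) i = b i := by
  obtain ⟨y', hy', hmax⟩ := h d ⟨y, hy⟩ (bddAbove_dualFeasible hx _)
  refine ⟨y', hy', fun i hi => ?_⟩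
  -- Complementary slackness: `y` has zero total slack at `x`, so the optimal `y'` has it too.
  have hle := hmax y hy
  rw [dualFeasible_dotProduct_eq hy b x, dualFeasible_dotProduct_eq hy' b x] at hle
  have hy0 : y ⬝ᵥ (A *ᵥ x - b) = 0 := by
    refine Finset.sum_eq_zero fun i _ => ?_
    by_cases hi : y i = 0
    · rw [hi, zero_mul]
    · rw [Pi.sub_apply, hslack i hi, sub_self, mul_zero]
  have hnn : ∀ j ∈ Finset.univ, 0 ≤ (y' j : ℝ) * (A *ᵥ x - b) j :=
    fun j _ => mul_nonneg (hy'.1 j) (sub_nonneg.mpr (hx j))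
  have h0 : ∑ j, (y' j : ℝ) * (A *ᵥ x - b) j = 0 := by
    refine le_antisymm ?_ (Finset.sum_nonneg hnn)
    simp only [dotProduct] at hle hy0
    linarith
  have := (Finset.sum_eq_zero_iff_of_nonneg hnn).mp h0 i (Finset.mem_univ i)
  rcases mul_eq_zero.mp this with h1 | h1
  · exact absurd (by exact_mod_cast h1) hi
  · exact sub_eq_zero.mp h1

/-- The optimum of an integral objective over a TDI system with integral right-hand side is an
integer. -/
theorem IsTDI.exists_int_eq_min {ι S : Type*} [Fintype ι] [Fintype S] {A : Matrix ι S ℝ}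
    {p : ι → ℤ} (h : IsTDI A fun i => (p i : ℝ)) {d : S → ℤ} {x : S → ℝ}
    (hx : x ∈ polyhedron A fun i => (p i : ℝ))
    (hmin : ∀ x' ∈ polyhedron A fun i => (p i : ℝ),
      (fun s => (d s : ℝ)) ⬝ᵥ x ≤ (fun s => (d s : ℝ)) ⬝ᵥ x') :
    ∃ k : ℤ, (fun s => (d s : ℝ)) ⬝ᵥ x = k := by
  obtain ⟨y, hy, hyx⟩ := exists_dualFeasible_of_forall_le ⟨x, hx⟩ hmin
  obtain ⟨y', hy', hmax⟩ := h d ⟨y, hy⟩ (bddAbove_dualFeasible hx _)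
  refine ⟨y' ⬝ᵥ p, le_antisymm ?_ ?_⟩
  · refine (hyx.trans (hmax y hy)).trans (le_of_eq ?_)
    simp [dotProduct]
  · refine le_trans (le_of_eq ?_) (dualFeasible_dotProduct_le hy' hx)
    simp [dotProduct]

/-- The least value of a coordinate on the optimal face of an integral objective over a TDI system
with integral right-hand side is an integer. -/
theorem IsTDI.exists_int_eq_min_face {ι S : Type*} [Fintype ι] [Fintype S] [DecidableEq S]
    {A : Matrix ι S ℝ} {p : ι → ℤ} (h : IsTDI A fun i => (p i : ℝ)) {d : S → ℤ} {x : S → ℝ}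
    (hx : x ∈ polyhedron A fun i => (p i : ℝ))
    (hmin : ∀ x' ∈ polyhedron A fun i => (p i : ℝ),
      (fun s => (d s : ℝ)) ⬝ᵥ x ≤ (fun s => (d s : ℝ)) ⬝ᵥ x') (s : S)
    (hs : ∀ x' ∈ polyhedron A fun i => (p i : ℝ),
      (fun s => (d s : ℝ)) ⬝ᵥ x' ≤ (fun s => (d s : ℝ)) ⬝ᵥ x → x s ≤ x' s) :
    ∃ k : ℤ, x s = k := by
  set δ : S → ℝ := fun s => (d s : ℝ) with hδ
  have hface : ∀ x', x' ∈ polyhedron (fun o : Option ι => o.elim (-δ) A)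
      (fun o => o.elim (-(δ ⬝ᵥ x)) fun i => (p i : ℝ)) ↔
      x' ∈ polyhedron A (fun i => (p i : ℝ)) ∧ δ ⬝ᵥ x' ≤ δ ⬝ᵥ x := by
    intro x'
    refine ⟨fun hx' => ⟨fun i => hx' (some i), ?_⟩, fun hx' o => ?_⟩
    · have : -(δ ⬝ᵥ x) ≤ (-δ) ⬝ᵥ x' := hx' none
      rw [neg_dotProduct] at this
      linarith
    · cases o with
      | none =>
        change -(δ ⬝ᵥ x) ≤ (-δ) ⬝ᵥ x'
        rw [neg_dotProduct]
        linarith [hx'.2]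
      | some i => exact hx'.1 i
  obtain ⟨y, hy, hyx⟩ := exists_dualFeasible_of_forall_le (d := Pi.single s 1) (m := x s)
    ⟨x, (hface x).mpr ⟨hx, le_rfl⟩⟩ (by
      intro x' hx'
      rw [single_dotProduct, one_mul]
      exact hs x' ((hface x').mp hx').1 ((hface x').mp hx').2)
  -- `μ` is the multiplier of the constraint defining the optimal face. For an integer `N ≥ μ` the
  -- penalized objective `x s + N (δ ⬝ᵥ x)` is minimized at `x` over the whole polyhedron. Its value
  -- and `δ ⬝ᵥ x` are integers, hence so is `x s`.
  set μ := y none with hμ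
  obtain ⟨N, hN⟩ : ∃ N : ℤ, μ ≤ N := ⟨⌈μ⌉, Int.le_ceil μ⟩
  have hlow : ∀ x' ∈ polyhedron A fun i => (p i : ℝ),
      x s + N * (δ ⬝ᵥ x) ≤ x' s + N * (δ ⬝ᵥ x') := by
    intro x' hx'
    have h1 : x s + μ * (δ ⬝ᵥ x) ≤ (fun i => y (some i)) ⬝ᵥ fun i => (p i : ℝ) := by
      rw [dotProduct, Fintype.sum_option] at hyx
      simp only [Option.elim] at hyx
      simp only [dotProduct] at hyx ⊢
      linarith
    have h2 : (fun i => y (some i)) ∈ dualFeasible A (Pi.single s 1 + μ • δ) := by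
      refine ⟨fun i => hy.1 _, ?_⟩
      ext r
      have := congrFun hy.2 r
      simp only [vecMul, dotProduct, Fintype.sum_option, Option.elim, Pi.neg_apply] at this
      simp only [vecMul, dotProduct, Pi.add_apply, Pi.smul_apply, smul_eq_mul]
      linarith
    have h3 := dualFeasible_dotProduct_le h2 hx'
    rw [add_dotProduct, smul_dotProduct, single_dotProduct, one_mul, smul_eq_mul] at h3
    have h4 : 0 ≤ (N - μ) * (δ ⬝ᵥ x' - δ ⬝ᵥ x) :=
      mul_nonneg (by linarith) (by linarith [hmin x' hx'])
    linarith
  have hobj : ∀ x' : S → ℝ,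
      (fun r => (((Pi.single s 1 + N • d : S → ℤ) r : ℤ) : ℝ)) ⬝ᵥ x' = x' s + N * (δ ⬝ᵥ x') := by
    intro x'
    have : (fun r => (((Pi.single s 1 + N • d : S → ℤ) r : ℤ) : ℝ)) =
        Pi.single s 1 + (N : ℝ) • δ := by
      ext r
      by_cases hr : r = s
      · subst hr
        simp [hδ]
      · simp [hδ, hr]
    rw [this, add_dotProduct, smul_dotProduct, single_dotProduct, one_mul, smul_eq_mul]
  obtain ⟨k, hk⟩ := h.exists_int_eq_min (d := Pi.single s 1 + N • d) hx (by
    intro x' hx'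
    rw [hobj, hobj]
    exact hlow x' hx')
  obtain ⟨m, hm⟩ := h.exists_int_eq_min hx hmin
  refine ⟨k - N * m, ?_⟩
  rw [hobj] at hk
  push_cast
  rw [← hk, hδ, hm]
  ring

/-! ### Integral points of box-TDI polyhedra. -/

theorem mem_polyhedron_box {ι S : Type*} [Fintype S] [DecidableEq S] {A : Matrix ι S ℝ}
    {b : ι → ℝ} {f g x : S → ℝ} :
    x ∈ polyhedron (fromRows A (fromRows (1 : Matrix S S ℝ) (-1 : Matrix S S ℝ)))
      (Sum.elim b (Sum.elim f fun s => -(g s))) ↔ x ∈ polyhedron A b ∧ f ≤ x ∧ x ≤ g := by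
  simp only [polyhedron, Set.mem_ofPred_eq, fromRows_mulVec, one_mulVec, neg_mulVec, Pi.le_def,
    Sum.forall, Sum.elim_inl, Sum.elim_inr, Pi.neg_apply, neg_le_neg_iff]

theorem isClosed_polyhedron {ι S : Type*} [Fintype S] (A : Matrix ι S ℝ) (b : ι → ℝ) :
    IsClosed (polyhedron A b) :=
  isClosed_le continuous_const (Continuous.matrix_mulVec continuous_const continuous_id)

/-- A box-TDI system stays TDI when an integral box is added. -/
theorem IsBoxTDI.isTDI_int {ι S : Type*} [Fintype ι] [Fintype S] [DecidableEq S]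
    {A : Matrix ι S ℝ} {b : ι → ℝ} (h : IsBoxTDI A b) {f g : S → ℤ} (hfg : f ≤ g) :
    IsTDI (fromRows A (fromRows (1 : Matrix S S ℝ) (-1 : Matrix S S ℝ)))
      (Sum.elim b (Sum.elim (fun s => (f s : ℝ)) (fun s => -(g s : ℝ)))) := by
  have := h (fun s => (f s : ℚ)) (fun s => (g s : ℚ)) (fun s => Int.cast_le.mpr (hfg s))
  simpa using this

/-- A box-TDI polyhedron with integral right-hand side, intersected with an integral box, contains
an integral optimal solution for each integral objective. -/
theorem IsBoxTDI.exists_integral_point {ι S : Type*} [Fintype ι] [Fintype S] [DecidableEq S]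
    {A : Matrix ι S ℝ} {p : ι → ℤ} (h : IsBoxTDI A fun i => (p i : ℝ)) {f₀ g₀ : S → ℤ}
    (d : S → ℤ) {x₀ : S → ℝ} (hx₀ : x₀ ∈ polyhedron A fun i => (p i : ℝ))
    (hf₀ : ∀ s, f₀ s ≤ x₀ s) (hg₀ : ∀ s, x₀ s ≤ g₀ s) :
    ∃ z : S → ℤ, (fun s => (z s : ℝ)) ∈ polyhedron A (fun i => (p i : ℝ)) ∧ f₀ ≤ z ∧ z ≤ g₀ ∧
      (fun s => (d s : ℝ)) ⬝ᵥ (fun s => (z s : ℝ)) ≤ (fun s => (d s : ℝ)) ⬝ᵥ x₀ := by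
  have key : ∀ t : Finset S, ∃ f g : S → ℤ, ∃ x ∈ polyhedron A fun i => (p i : ℝ),
      f₀ ≤ f ∧ g ≤ g₀ ∧ (∀ s, (f s : ℝ) ≤ x s) ∧ (∀ s, x s ≤ g s) ∧ (∀ s ∈ t, f s = g s) ∧
        (fun s => (d s : ℝ)) ⬝ᵥ x ≤ (fun s => (d s : ℝ)) ⬝ᵥ x₀ := by
    intro t
    induction t using Finset.induction_on with
    | empty => exact ⟨f₀, g₀, x₀, hx₀, le_rfl, le_rfl, hf₀, hg₀, by simp, le_rfl⟩
    | insert s t _ ih =>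
      obtain ⟨f, g, x₁, hx₁, hf, hg, hfx, hgx, hfg, hdx⟩ := ih
      have hle : f ≤ g := fun r => by exact_mod_cast (hfx r).trans (hgx r)
      set P := polyhedron A (fun i => (p i : ℝ)) ∩
        Set.Icc (fun s => (f s : ℝ)) (fun s => (g s : ℝ)) with hP
      have hPc : IsCompact P := isCompact_Icc.inter_left (isClosed_polyhedron A _)
      have hcont : Continuous fun x : S → ℝ => (fun s => (d s : ℝ)) ⬝ᵥ x :=
        Continuous.dotProduct continuous_const continuous_id
      -- Minimize `d`, then coordinate `s` on the optimal face. The resulting coordinate is an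
      -- integer, so the box can be collapsed to it without raising the objective.
      obtain ⟨x₂, hx₂, hmin₂⟩ := hPc.exists_isMinOn ⟨x₁, hx₁, hfx, hgx⟩ hcont.continuousOn
      have hFc : IsCompact (P ∩ {x | (fun s => (d s : ℝ)) ⬝ᵥ x ≤ (fun s => (d s : ℝ)) ⬝ᵥ x₂}) :=
        hPc.inter_right (isClosed_le hcont continuous_const)
      obtain ⟨x₃, hx₃, hmin₃⟩ := hFc.exists_isMinOn ⟨x₂, hx₂, le_rfl (a := (fun s => (d s : ℝ)) ⬝ᵥ x₂)⟩
        (continuous_apply s).continuousOn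
      have hTDI := h.isTDI_int hle
      have hrhs : (Sum.elim (fun i => (p i : ℝ)) (Sum.elim (fun s => (f s : ℝ))
          (fun s => -(g s : ℝ)))) = fun k => ((Sum.elim p (Sum.elim f (fun s => -g s)) k : ℤ) : ℝ) := by
        ext (_ | _ | _) <;> simp
      have hmem : ∀ x, x ∈ polyhedron (fromRows A (fromRows (1 : Matrix S S ℝ) (-1 : Matrix S S ℝ)))
          (fun k => ((Sum.elim p (Sum.elim f (fun s => -g s)) k : ℤ) : ℝ)) ↔ x ∈ P := by
        intro x
        rw [← hrhs, mem_polyhedron_box]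
        exact Iff.rfl
      rw [hrhs] at hTDI
      obtain ⟨k, hk⟩ := hTDI.exists_int_eq_min_face (d := d) ((hmem _).mpr hx₃.1)
        (fun x' hx' => le_trans hx₃.2 (hmin₂ ((hmem _).mp hx'))) s
        (fun x' hx' hdx' => hmin₃ ⟨(hmem _).mp hx', le_trans hdx' hx₃.2⟩)
      have hfk : f s ≤ k := by
        have : (f s : ℝ) ≤ x₃ s := hx₃.1.2.1 s
        rw [hk] at this
        exact_mod_cast this
      have hgk : k ≤ g s := by
        have : x₃ s ≤ (g s : ℝ) := hx₃.1.2.2 s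
        rw [hk] at this
        exact_mod_cast this
      refine ⟨Function.update f s k, Function.update g s k, x₃, hx₃.1.1, ?_, ?_, ?_, ?_, ?_, ?_⟩
      · exact le_update_iff.mpr ⟨(hf s).trans hfk, fun r _ => hf r⟩
      · exact update_le_iff.mpr ⟨hgk.trans (hg s), fun r _ => hg r⟩
      · intro r
        rcases eq_or_ne r s with rfl | hr
        · rw [Function.update_self, hk]
        · rw [Function.update_of_ne hr]
          exact hx₃.1.2.1 r
      · intro r
        rcases eq_or_ne r s with rfl | hr
        · rw [Function.update_self, hk]
        · rw [Function.update_of_ne hr]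
          exact hx₃.1.2.2 r
      · intro r hr
        rcases eq_or_ne r s with rfl | hrs
        · rw [Function.update_self, Function.update_self]
        · rw [Function.update_of_ne hrs, Function.update_of_ne hrs]
          exact hfg r (Finset.mem_of_mem_insert_of_ne hr hrs)
      · exact le_trans hx₃.2 ((hmin₂ ⟨hx₁, hfx, hgx⟩).trans hdx)
  obtain ⟨f, g, x, hx, hf, hg, hfx, hgx, hfg, hdx⟩ := key Finset.univ
  have hxf : x = fun s => (f s : ℝ) := by
    ext s
    refine le_antisymm ?_ (hfx s)
    rw [hfg s (Finset.mem_univ s)]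
    exact hgx s
  subst hxf
  exact ⟨f, hx, hf, fun s => (hfg s (Finset.mem_univ s)).le.trans (hg s), hdx⟩

/-! ### Integral vectors in tight cones. -/

/-- The cone of the rows of a box-TDI system that are tight at an integral feasible point: if a
vector of the cone has integral coordinates outside `t`, then so has a nonnegative integral
combination of these rows, with the same coordinates outside `t`. -/
theorem IsBoxTDI.exists_integral_coord {ι S : Type*} [Fintype ι] [Fintype S] [DecidableEq S]
    {A : Matrix ι S ℝ} {b : ι → ℝ} (h : IsBoxTDI A b) {z : S → ℤ}
    (hz : (fun s => (z s : ℝ)) ∈ polyhedron A b) (t : Finset S) {y : ι → ℝ} (hy0 : 0 ≤ y)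
    (hslack : ∀ i, y i ≠ 0 → (A *ᵥ fun s => (z s : ℝ)) i = b i) {k : S → ℤ}
    (hk : ∀ s ∉ t, (y ᵥ* A) s = k s) :
    ∃ y' : ι → ℤ, 0 ≤ y' ∧ (∀ i, y' i ≠ 0 → (A *ᵥ fun s => (z s : ℝ)) i = b i) ∧
      ∀ s ∉ t, ((fun i => (y' i : ℝ)) ᵥ* A) s = k s := by
  -- At `z` both bounds are tight for `s ∈ t` and neither is tight for `s ∉ t`, so bound rows can
  -- only change the coordinates in `t`.
  set f : S → ℤ := fun s => if s ∈ t then z s else z s - 1 with hf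
  set g : S → ℤ := fun s => if s ∈ t then z s else z s + 1 with hg
  have hfz : f ≤ z := fun s => by
    simp only [hf]
    split_ifs <;> omega
  have hzg : z ≤ g := fun s => by
    simp only [hg]
    split_ifs <;> omega
  -- The error to be corrected; its positive and negative parts serve as multipliers of the lower
  -- and upper bound rows.
  set e : S → ℝ := fun s => k s - (y ᵥ* A) s with he
  have he0 : ∀ s ∉ t, e s = 0 := fun s hs => sub_eq_zero.mpr (hk s hs).symm
  obtain ⟨y', hy', hs'⟩ := (h.isTDI_int (hfz.trans hzg)).exists_integral_slack
    (mem_polyhedron_box.mpr ⟨hz, fun s => Int.cast_le.mpr (hfz s),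
      fun s => Int.cast_le.mpr (hzg s)⟩) (d := k)
    (y := Sum.elim y (Sum.elim (fun s => max (e s) 0) fun s => max (-e s) 0))
    ⟨by
      rintro (i | s | s)
      · exact hy0 i
      · exact le_max_right _ _
      · exact le_max_right _ _, by
      rw [vecMul_fromRows, Sum.elim_comp_inl, Sum.elim_comp_inr, vecMul_fromRows,
        Sum.elim_comp_inl, Sum.elim_comp_inr, vecMul_one, vecMul_neg, vecMul_one]
      ext s
      have := max_zero_sub_max_neg_zero_eq_self (e s)
      have hes : e s = k s - (y ᵥ* A) s := rfl
      change (y ᵥ* A) s + (max (e s) 0 + -max (-e s) 0) = k s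
      linarith⟩ (by
      rintro (i | s | s) hi
      · simpa [fromRows_mulVec] using hslack i hi
      · have hst : s ∈ t := by
          by_contra hst
          simp [he0 s hst] at hi
        simp [fromRows_mulVec, hf, hst]
      · have hst : s ∈ t := by
          by_contra hst
          simp [he0 s hst] at hi
        simp [fromRows_mulVec, neg_mulVec, hg, hst])
  refine ⟨fun i => y' (Sum.inl i), fun i => ?_, fun i hi => ?_, fun s hs => ?_⟩
  · have : (0 : ℝ) ≤ y' (Sum.inl i) := hy'.1 (Sum.inl i)
    exact_mod_cast this
  · simpa [fromRows_mulVec] using hs' (Sum.inl i) hi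
  · have h1 : y' (Sum.inr (Sum.inl s)) = 0 := by
      by_contra hne
      have := hs' _ hne
      simp [fromRows_mulVec, hf, hs, eq_sub_iff_add_eq] at this
    have h2 : y' (Sum.inr (Sum.inr s)) = 0 := by
      by_contra hne
      have := hs' _ hne
      simp [fromRows_mulVec, neg_mulVec, hg, hs] at this
    have h3 := congrFun hy'.2 s
    rw [vecMul_fromRows, vecMul_fromRows, vecMul_one, vecMul_neg, vecMul_one] at h3
    simp only [Pi.add_apply, Pi.neg_apply, Function.comp_apply, h1, h2, Int.cast_zero, neg_zero,
      add_zero] at h3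
    exact h3

theorem vecMul_map_intCast {ι S : Type*} [Fintype ι] (Q : Matrix ι S ℤ) (y : ι → ℤ) (s : S) :
    ((fun i => (y i : ℝ)) ᵥ* Q.map fun k : ℤ => (k : ℝ)) s = ((y ᵥ* Q) s : ℤ) := by
  simp [vecMul, dotProduct]

/-- The cone of the tight rows of an integral box-TDI system at an integral feasible point meets
an integral box in an integral combination of these rows, unless they are disjoint. -/
theorem IsBoxTDI.exists_integral_between {ι S : Type*} [Fintype ι] [Fintype S] [DecidableEq S]
    {Q : Matrix ι S ℤ} {b : ι → ℝ} (h : IsBoxTDI (Q.map fun k : ℤ => (k : ℝ)) b) {z : S → ℤ}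
    (hz : (fun s => (z s : ℝ)) ∈ polyhedron (Q.map fun k : ℤ => (k : ℝ)) b) {l u : S → ℤ}
    {y : ι → ℝ} (hy0 : 0 ≤ y)
    (hslack : ∀ i, y i ≠ 0 → ((Q.map fun k : ℤ => (k : ℝ)) *ᵥ fun s => (z s : ℝ)) i = b i)
    (hl : ∀ s, l s ≤ (y ᵥ* Q.map fun k : ℤ => (k : ℝ)) s)
    (hu : ∀ s, (y ᵥ* Q.map fun k : ℤ => (k : ℝ)) s ≤ u s) :
    ∃ y' : ι → ℤ, 0 ≤ y' ∧
      (∀ i, y' i ≠ 0 → ((Q.map fun k : ℤ => (k : ℝ)) *ᵥ fun s => (z s : ℝ)) i = b i) ∧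
      l ≤ y' ᵥ* Q ∧ y' ᵥ* Q ≤ u := by
  set A : Matrix ι S ℝ := Q.map fun k : ℤ => (k : ℝ) with hA
  -- Induction on the number of fractional coordinates of `w`: move towards an integral cone point
  -- `w'` that agrees with `w` in its integral coordinates until another coordinate becomes
  -- integral.
  induction hn : (Finset.univ.filter fun s => Int.fract ((y ᵥ* A) s) ≠ 0).card
    using Nat.strong_induction_on generalizing y with
  | _ n ih =>
  set t := Finset.univ.filter fun s => Int.fract ((y ᵥ* A) s) ≠ 0 with ht
  set w := y ᵥ* A with hw
  have hwt : ∀ s ∉ t, w s = (⌊w s⌋ : ℤ) := by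
    intro s hs
    have : Int.fract (w s) = 0 := by simpa [ht] using hs
    rwa [Int.fract, sub_eq_zero] at this
  obtain ⟨y', hy', hs', hw'⟩ := h.exists_integral_coord hz t hy0 hslack hwt
  have hcast : ∀ s, ((fun i => (y' i : ℝ)) ᵥ* A) s = ((y' ᵥ* Q) s : ℤ) :=
    vecMul_map_intCast Q y'
  rcases t.eq_empty_or_nonempty with hte | htne
  · have hww : ∀ s, ((y' ᵥ* Q) s : ℝ) = w s := by
      intro s
      have hs : s ∉ t := by simp [hte]
      rw [← hcast, hw' s hs, ← hwt s hs]
    refine ⟨y', hy', hs', fun s => ?_, fun s => ?_⟩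
    · have := hl s
      rw [← hww] at this
      exact_mod_cast this
    · have := hu s
      rw [← hww] at this
      exact_mod_cast this
  · set w' : S → ℤ := y' ᵥ* Q with hw'def
    have hne : ∀ s ∈ t, (w' s : ℝ) - w s ≠ 0 := by
      intro s hs h0
      have : Int.fract (w s) ≠ 0 := (Finset.mem_filter.mp hs).2
      rw [← sub_eq_zero.mp h0, Int.fract_intCast] at this
      exact this rfl
    -- The first integer met by coordinate `s` on the way from `w s` to `w' s`; the least ratio `r`
    -- stops at the first such event. No coordinate leaves `[⌊w s⌋, ⌈w s⌉]`, hence none leaves the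
    -- integral box.
    set m : S → ℤ := fun s => if w s < w' s then ⌈w s⌉ else ⌊w s⌋ with hm
    obtain ⟨s₀, hs₀, hmin⟩ := t.exists_min_image (fun s => (m s - w s) / (w' s - w s)) htne
    set r := ((m s₀ : ℝ) - w s₀) / (w' s₀ - w s₀) with hr
    have hm1 : ∀ s, w s < w' s → w s ≤ m s ∧ (m s : ℝ) ≤ w' s := by
      intro s hlt
      simp only [hm, if_pos hlt]
      exact ⟨Int.le_ceil _, Int.cast_le.mpr (Int.ceil_le.mpr hlt.le)⟩
    have hm2 : ∀ s, ¬ w s < w' s → (w' s : ℝ) ≤ m s ∧ (m s : ℝ) ≤ w s := by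
      intro s hlt
      simp only [hm, if_neg hlt]
      exact ⟨Int.cast_le.mpr (Int.le_floor.mpr (not_lt.mp hlt)), Int.floor_le _⟩
    have hr0 : 0 ≤ r := by
      by_cases hlt : w s₀ < w' s₀
      · exact div_nonneg (by linarith [(hm1 _ hlt).1]) (by linarith)
      · exact div_nonneg_of_nonpos (by linarith [(hm2 _ hlt).2]) (by linarith)
    have hr1 : r ≤ 1 := by
      by_cases hlt : w s₀ < w' s₀
      · exact div_le_one_of_le₀ (by linarith [(hm1 _ hlt).2]) (by linarith)
      · exact div_le_one_of_ge (by linarith [(hm2 _ hlt).1]) (by linarith)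
    set y₂ : ι → ℝ := (1 - r) • y + r • fun i => (y' i : ℝ) with hy₂
    have hw₂ : ∀ s, (y₂ ᵥ* A) s = w s + r * (w' s - w s) := by
      intro s
      rw [hy₂, add_vecMul, smul_vecMul, smul_vecMul, Pi.add_apply, Pi.smul_apply, Pi.smul_apply,
        hcast s, smul_eq_mul, smul_eq_mul]
      ring
    have hoff : ∀ s ∉ t, (y₂ ᵥ* A) s = w s := by
      intro s hs
      rw [hw₂, ← hcast, hw' s hs, ← hwt s hs, sub_self, mul_zero, add_zero]
    have hon : ∀ s ∈ t, (⌊w s⌋ : ℝ) ≤ (y₂ ᵥ* A) s ∧ (y₂ ᵥ* A) s ≤ ⌈w s⌉ := by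
      intro s hs
      rw [hw₂]
      have h1 := hmin s hs
      by_cases hlt : w s < w' s
      · rw [le_div_iff₀ (by linarith)] at h1
        have h2 : 0 ≤ r * (w' s - w s) := mul_nonneg hr0 (by linarith)
        refine ⟨by linarith [Int.floor_le (w s)], ?_⟩
        simp only [hm, if_pos hlt] at h1
        linarith
      · have h3 : (w' s : ℝ) - w s < 0 := lt_of_le_of_ne (by linarith) (hne s hs)
        rw [le_div_iff_of_neg h3] at h1
        have h2 : r * (w' s - w s) ≤ 0 := mul_nonpos_of_nonneg_of_nonpos hr0 h3.le
        refine ⟨?_, by linarith [Int.le_ceil (w s)]⟩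
        simp only [hm, if_neg hlt] at h1
        linarith
    refine ih _ ?_ (y := y₂) ?_ ?_ ?_ ?_ rfl
    · rw [← hn]
      refine Finset.card_lt_card (Finset.ssubset_iff_subset_ne.mpr ⟨fun s hs => ?_, fun heq => ?_⟩)
      · by_contra hst
        have h1 := (Finset.mem_filter.mp hs).2
        rw [hoff s hst, hwt s hst, Int.fract_intCast] at h1
        exact h1 rfl
      · rw [← heq] at hs₀
        have h1 := (Finset.mem_filter.mp hs₀).2
        rw [heq] at hs₀
        rw [hw₂, hr, div_mul_cancel₀ _ (hne s₀ hs₀), add_sub_cancel, Int.fract_intCast] at h1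
        exact h1 rfl
    · intro i
      have h1 : (0 : ℝ) ≤ y' i := by exact_mod_cast hy' i
      exact add_nonneg (mul_nonneg (by linarith) (hy0 i)) (mul_nonneg hr0 h1)
    · intro i hi
      by_cases h1 : y i = 0
      · by_cases h2 : y' i = 0
        · simp [hy₂, h1, h2] at hi
        · exact hs' i h2
      · exact hslack i h1
    · intro s
      by_cases hs : s ∈ t
      · exact le_trans (Int.cast_le.mpr (Int.le_floor.mpr (hl s))) (hon s hs).1
      · rw [hoff s hs]
        exact hl s
    · intro s
      by_cases hs : s ∈ t
      · exact le_trans (hon s hs).2 (Int.cast_le.mpr (Int.ceil_le.mpr (hu s)))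
      · rw [hoff s hs]
        exact hu s

/-! ### Necessity of the optimality criterion. -/

/-- Moving from a feasible point a little in a direction that respects the tight inequalities. -/
theorem eventually_add_smul_mem_polyhedron {ι S : Type*} [Fintype ι] [Fintype S]
    {A : Matrix ι S ℝ} {b : ι → ℝ} {x v : S → ℝ} (hx : x ∈ polyhedron A b)
    (hv : ∀ i, (A *ᵥ x) i = b i → 0 ≤ (A *ᵥ v) i) :
    ∀ᶠ ε in 𝓝[>] (0 : ℝ), x + ε • v ∈ polyhedron A b := by
  have : ∀ i, ∀ᶠ ε in 𝓝[>] (0 : ℝ), b i ≤ (A *ᵥ x) i + ε * (A *ᵥ v) i := by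
    intro i
    by_cases hi : (A *ᵥ x) i = b i
    · filter_upwards [self_mem_nhdsWithin] with ε hε
      rw [hi]
      exact le_add_of_nonneg_right (mul_nonneg (le_of_lt hε) (hv i hi))
    · have hlt : b i < (A *ᵥ x) i + 0 * (A *ᵥ v) i := by
        rw [zero_mul, add_zero]
        exact lt_of_le_of_ne (hx i) (Ne.symm hi)
      have hc : Continuous fun ε : ℝ => (A *ᵥ x) i + ε * (A *ᵥ v) i := by fun_prop
      exact nhdsWithin_le_nhds ((hc.continuousAt.eventually (lt_mem_nhds hlt)).mono
        fun _ h => h.le)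
  filter_upwards [Filter.eventually_all.mpr this] with ε hε i
  simpa [mulVec_add, mulVec_smul] using hε i

/-- A cone spanned by some rows of a matrix meets a box, unless some direction separates them. -/
theorem exists_between_of_forall_direction {ι S : Type*} [Fintype ι] [Fintype S]
    (A : Matrix ι S ℝ) (I : Set ι) {l u : S → ℝ} (hlu : l ≤ u)
    (hdir : ∀ x : S → ℝ, (∀ i ∈ I, 0 ≤ (A *ᵥ x) i) →
      0 ≤ (fun s => if 0 ≤ x s then u s else l s) ⬝ᵥ x) :
    ∃ y : ι → ℝ, 0 ≤ y ∧ (∀ i, y i ≠ 0 → i ∈ I) ∧ l ≤ y ᵥ* A ∧ y ᵥ* A ≤ u := by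
  classical
  -- Both bounds are encoded in a doubled space: `(u, l)` is to be `(yA, yA)` plus a nonnegative
  -- slack in the first half and minus one in the second.
  obtain ⟨y, hy0, hyI, hy⟩ := farkas_finset
    (Finset.univ.filter fun k : ι ⊕ (S ⊕ S) => ∀ i, k = Sum.inl i → i ∈ I)
    (Sum.elim (fun i => Sum.elim (A i) (A i)) (Sum.elim (fun s => Sum.elim (Pi.single s 1) 0)
      fun s => Sum.elim 0 (Pi.single s (-1)))) (Sum.elim u l) (by
      intro x hx
      obtain ⟨α, β, rfl⟩ : ∃ α β : S → ℝ, x = Sum.elim α (-β) :=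
        ⟨x ∘ Sum.inl, -(x ∘ Sum.inr), by ext (_ | _) <;> simp⟩
      have hα : ∀ s, 0 ≤ α s := fun s => by
        simpa using hx (Sum.inr (Sum.inl s)) (by simp)
      have hβ : ∀ s, 0 ≤ β s := fun s => by
        simpa using hx (Sum.inr (Sum.inr s)) (by simp)
      have := hdir (α - β) (fun i hi => by
        have := hx (Sum.inl i) (by simpa using hi)
        simp only [Sum.elim_inl, sumElim_dotProduct_sumElim, ← dotProduct_add,
          ← sub_eq_add_neg] at this
        exact this)
      refine this.trans ?_
      rw [sumElim_dotProduct_sumElim, dotProduct, dotProduct, dotProduct,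
        ← Finset.sum_add_distrib]
      refine Finset.sum_le_sum fun s _ => ?_
      have h1 : 0 ≤ (u s - l s) * α s := mul_nonneg (sub_nonneg.mpr (hlu s)) (hα s)
      have h2 : 0 ≤ (u s - l s) * β s := mul_nonneg (sub_nonneg.mpr (hlu s)) (hβ s)
      simp only [Pi.sub_apply, Pi.neg_apply]
      split_ifs <;> linarith)
  have hy2 : ∑ k, y k • (Sum.elim (fun i => Sum.elim (A i) (A i))
      (Sum.elim (fun s => Sum.elim (Pi.single s 1) 0) fun s => Sum.elim 0 (Pi.single s (-1)))
        : ι ⊕ (S ⊕ S) → S ⊕ S → ℝ) k = Sum.elim u l := by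
    rw [← hy]
    refine (Finset.sum_subset (Finset.filter_subset _ _) fun k _ hk => ?_).symm
    rw [hyI k hk, zero_smul]
  have hcoord : ∀ k, (y k ≠ 0) → ∀ i, k = Sum.inl i → i ∈ I := by
    intro k hk
    by_contra hcon
    exact hk (hyI k (by simpa using hcon))
  refine ⟨fun i => y (Sum.inl i), fun i => hy0 _, fun i hi => hcoord _ hi i rfl, fun s => ?_,
    fun s => ?_⟩
  · have := congrFun hy2 (Sum.inr s)
    simp only [Fintype.sum_sum_type, Finset.sum_apply, Pi.smul_apply, Sum.elim_inl,
      Sum.elim_inr, smul_eq_mul, Pi.zero_apply, mul_zero, Finset.sum_const_zero, zero_add,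
      Pi.single_apply, mul_ite, Finset.sum_ite_eq, Finset.mem_univ, if_true] at this
    have h0 := hy0 (Sum.inr (Sum.inr s))
    simp only [vecMul, dotProduct]
    linarith
  · have := congrFun hy2 (Sum.inl s)
    simp only [Fintype.sum_sum_type, Finset.sum_apply, Pi.smul_apply, Sum.elim_inl,
      Sum.elim_inr, smul_eq_mul, Pi.zero_apply, mul_zero, Finset.sum_const_zero, add_zero,
      Pi.single_apply, mul_ite, Finset.sum_ite_eq, Finset.mem_univ, if_true] at this
    have h0 := hy0 (Sum.inr (Sum.inl s))
    simp only [vecMul, dotProduct]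
    linarith

/-- The optimality criterion is necessary. -/
theorem IsBoxTDI.exists_multiplier_of_isMinOn {ι S : Type*} [Fintype ι] [Fintype S]
    [DecidableEq S] {Q : Matrix ι S ℤ} {p : ι → ℤ} {c : S → ℤ} (hc : ∀ s, 0 < c s)
    (h : IsBoxTDI (Q.map fun k : ℤ => (k : ℝ)) fun i => (p i : ℝ)) {z : S → ℤ}
    (hz : (fun s => (z s : ℝ)) ∈ polyhedron (Q.map fun k : ℤ => (k : ℝ)) fun i => (p i : ℝ))
    (hmin : IsMinOn (weightedSquareSum c)
      (integralPoints (polyhedron (Q.map fun k : ℤ => (k : ℝ)) fun i => (p i : ℝ))) z) :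
    ∃ y : ι → ℤ, 0 ≤ y ∧
      (∀ i, y i ≠ 0 → ((Q.map fun k : ℤ => (k : ℝ)) *ᵥ fun s => (z s : ℝ)) i = p i) ∧
      (∀ s, c s * (2 * z s - 1) ≤ (y ᵥ* Q) s) ∧ ∀ s, (y ᵥ* Q) s ≤ c s * (2 * z s + 1) := by
  set A : Matrix ι S ℝ := Q.map fun k : ℤ => (k : ℝ) with hA
  set l : S → ℤ := fun s => c s * (2 * z s - 1) with hl
  set u : S → ℤ := fun s => c s * (2 * z s + 1) with hu
  obtain ⟨y, hy0, hyI, hly, hyu⟩ := exists_between_of_forall_direction A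
    {i | (A *ᵥ fun s => (z s : ℝ)) i = p i} (l := fun s => (l s : ℝ)) (u := fun s => (u s : ℝ))
    (fun s => by
      simp only [hl, hu, Int.cast_le]
      linarith [hc s]) (by
      intro x hx
      by_contra hneg
      rw [not_le] at hneg
      set d : S → ℤ := fun s => if 0 ≤ x s then u s else l s with hd
      have hdx : (fun s => (d s : ℝ)) ⬝ᵥ x < 0 := by
        refine lt_of_eq_of_lt (congrArg (· ⬝ᵥ x) ?_) hneg
        ext s
        simp only [hd]
        split_ifs <;> rfl
      have hsmall : ∀ s, ∀ᶠ ε in 𝓝[>] (0 : ℝ), |ε * x s| < 1 := by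
        intro s
        have hcont : Continuous fun ε : ℝ => |ε * x s| := by fun_prop
        exact nhdsWithin_le_nhds (hcont.continuousAt.eventually (gt_mem_nhds (by simp)))
      obtain ⟨ε, hε, hε1, hε0⟩ := ((eventually_add_smul_mem_polyhedron hz hx).and
        ((Filter.eventually_all.mpr hsmall).and self_mem_nhdsWithin)).exists
      have hε0 : 0 < ε := hε0
      obtain ⟨z', hz', hfz, hzg, hdz⟩ := h.exists_integral_point
        (f₀ := fun s => if 0 ≤ x s then z s else z s - 1)
        (g₀ := fun s => if 0 ≤ x s then z s + 1 else z s) d hε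
        (fun s => by
          have h1 := (abs_lt.mp (hε1 s)).1
          simp only [Pi.add_apply, Pi.smul_apply, smul_eq_mul]
          split_ifs with h0
          · linarith [mul_nonneg hε0.le h0]
          · push_cast
            linarith)
        (fun s => by
          have h1 := (abs_lt.mp (hε1 s)).2
          simp only [Pi.add_apply, Pi.smul_apply, smul_eq_mul]
          split_ifs with h0
          · push_cast
            linarith
          · linarith [mul_neg_of_pos_of_neg hε0 (not_le.mp h0)])
      have hlt : d ⬝ᵥ z' < d ⬝ᵥ z := by
        rw [dotProduct_add, dotProduct_smul, smul_eq_mul] at hdz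
        have h1 : (fun s => (d s : ℝ)) ⬝ᵥ (fun s => (z' s : ℝ)) <
            (fun s => (d s : ℝ)) ⬝ᵥ (fun s => (z s : ℝ)) := by
          linarith [mul_neg_of_pos_of_neg hε0 hdx]
        simp only [dotProduct] at h1 ⊢
        exact_mod_cast h1
      -- A step `+1` costs `c (2z + 1) = u` and a step `-1` costs `-c (2z - 1) = -l`. The box allows
      -- only steps in the direction of `x`, so `d` is exact there.
      have hdiff : weightedSquareSum c z' - weightedSquareSum c z = d ⬝ᵥ z' - d ⬝ᵥ z := by
        simp only [weightedSquareSum, dotProduct, ← Finset.sum_sub_distrib]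
        refine Finset.sum_congr rfl fun s _ => ?_
        have h1 := hfz s
        have h2 := hzg s
        beta_reduce at h1 h2
        simp only [hd, hl, hu]
        split_ifs at h1 h2 ⊢
        · obtain h3 | h3 : z' s = z s ∨ z' s = z s + 1 := by omega
          all_goals
            rw [h3]
            ring
        · obtain h3 | h3 : z' s = z s ∨ z' s = z s - 1 := by omega
          all_goals
            rw [h3]
            ring
      have := hmin (a := z') hz'
      simp only [Set.mem_ofPred_eq] at this
      linarith)
  exact h.exists_integral_between hz hy0 hyI hly hyu

/-! ### Carathéodory's theorem modulo a subspace. -/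

/-- Among the nonnegative combinations of vectors representing `w` modulo a subspace `L`, one of
largest coefficient sum uses at most `codim L` vectors, if these vectors lie strictly on one side
of a hyperplane through `L`. -/
theorem exists_isMaxOn_sum_card_le_codim {ι S : Type*} [Fintype ι] [Fintype S]
    (L : Submodule ℝ (S → ℝ)) (a : ι → S → ℝ) (J : Set ι) (w : S → ℝ) (φ : (S → ℝ) →ₗ[ℝ] ℝ)
    (hφL : ∀ v ∈ L, φ v = 0) (hφJ : ∀ i ∈ J, 0 < φ (a i)) {r₀ : ι → ℝ} (hr₀ : 0 ≤ r₀)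
    (hr₀J : ∀ i ∉ J, r₀ i = 0) (hr₀L : w - ∑ i, r₀ i • a i ∈ L) :
    ∃ r : ι → ℝ, 0 ≤ r ∧ (∀ i ∉ J, r i = 0) ∧ w - ∑ i, r i • a i ∈ L ∧
      (∀ r' : ι → ℝ, 0 ≤ r' → (∀ i ∉ J, r' i = 0) → w - ∑ i, r' i • a i ∈ L →
        ∑ i, r' i ≤ ∑ i, r i) ∧
      (Finset.univ.filter fun i => r i ≠ 0).card ≤ Module.finrank ℝ ((S → ℝ) ⧸ L) := by
  classical
  set X : Set (ι → ℝ) := {r | 0 ≤ r ∧ (∀ i ∉ J, r i = 0) ∧ w - ∑ i, r i • a i ∈ L} with hX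
  have hXc : IsCompact X := by
    -- Applying `φ` to the representation gives `∑ r i * φ (a i) = φ w`, which bounds every
    -- coefficient.
    have hsub : X ⊆ Set.Icc 0 fun i => if i ∈ J then φ w / φ (a i) else 0 := by
      rintro r ⟨hr0, hrJ, hrL⟩
      refine ⟨hr0, fun i => ?_⟩
      beta_reduce
      split_ifs with hi
      · rw [le_div_iff₀ (hφJ i hi)]
        have h1 := hφL _ hrL
        rw [map_sub, sub_eq_zero, map_sum] at h1
        simp only [map_smul, smul_eq_mul] at h1
        rw [h1]
        refine Finset.single_le_sum (f := fun i => r i * φ (a i)) (fun j _ => ?_)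
          (Finset.mem_univ i)
        by_cases hj : j ∈ J
        · exact mul_nonneg (hr0 j) (hφJ j hj).le
        · simp [hrJ j hj]
      · exact (hrJ i hi).le
    refine isCompact_Icc.of_isClosed_subset ?_ hsub
    refine (isClosed_le continuous_const continuous_id).inter (IsClosed.inter ?_ ?_)
    · have hJeq : {r : ι → ℝ | ∀ i ∉ J, r i = 0} = ⋂ i, ⋂ (_ : i ∉ J), {r | r i = 0} := by
        ext r
        simp
      change IsClosed {r : ι → ℝ | ∀ i ∉ J, r i = 0}
      rw [hJeq]
      exact isClosed_iInter fun i => isClosed_iInter fun _ =>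
        isClosed_eq (continuous_apply i) continuous_const
    · exact (Submodule.closed_of_finiteDimensional L).preimage (by fun_prop)
  obtain ⟨r₁, hr₁, hmax₁⟩ := hXc.exists_isMaxOn ⟨r₀, hr₀, hr₀J, hr₀L⟩
    (f := fun r => ∑ i, r i) (by fun_prop)
  have key : ∀ n, ∀ r ∈ X, IsMaxOn (fun r : ι → ℝ => ∑ i, r i) X r →
      (Finset.univ.filter fun i => r i ≠ 0).card = n →
      ∃ r ∈ X, IsMaxOn (fun r : ι → ℝ => ∑ i, r i) X r ∧
        (Finset.univ.filter fun i => r i ≠ 0).card ≤ Module.finrank ℝ ((S → ℝ) ⧸ L) := by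
    intro n
    induction n using Nat.strong_induction_on with
    | _ n ih =>
    intro r hr hmax hn
    set s := Finset.univ.filter fun i => r i ≠ 0 with hs
    by_cases hli : LinearIndepOn ℝ (fun i => L.mkQ (a i)) (s : Set ι)
    · refine ⟨r, hr, hmax, ?_⟩
      simpa using LinearIndependent.fintype_card_le_finrank hli
    -- A dependence modulo `L`, with its sign chosen so that adding it does not lower the
    -- coefficient sum.
    obtain ⟨e, heL, hes, hepos, j, hj⟩ : ∃ e : ι → ℝ, ∑ i, e i • a i ∈ L ∧
        (∀ i ∉ s, e i = 0) ∧ 0 ≤ ∑ i, e i ∧ ∃ j, e j ≠ 0 := by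
      rw [linearIndepOn_finset_iff] at hli
      push Not at hli
      obtain ⟨f, hf, j, hjs, hfj⟩ := hli
      have h1 : ∑ i, (if i ∈ s then f i else 0) • a i ∈ L := by
        simp only [ite_smul, zero_smul, Finset.sum_ite_mem, Finset.univ_inter]
        rw [← Submodule.Quotient.mk_eq_zero, ← Submodule.mkQ_apply, map_sum, ← hf]
        simp only [map_smul]
      rcases le_total 0 (∑ i, if i ∈ s then f i else 0) with h0 | h0
      · exact ⟨fun i => if i ∈ s then f i else 0, h1, fun i hi => if_neg hi, h0, j, by
          simpa [hjs] using hfj⟩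
      · refine ⟨fun i => -if i ∈ s then f i else 0, ?_, fun i hi => by simp [hi], ?_, j, by
          simpa [hjs] using hfj⟩
        · simpa only [neg_smul, Finset.sum_neg_distrib] using L.neg_mem h1
        · rw [Finset.sum_neg_distrib]
          linarith
    have hsJ : ∀ i ∈ s, i ∈ J := fun i hi => by
      by_contra hiJ
      exact (Finset.mem_filter.mp hi).2 (hr.2.1 i hiJ)
    -- A nonzero `e ≥ 0` would make `φ` positive on a vector of `L`. So moving along `e` eventually
    -- makes a coefficient vanish.
    obtain ⟨i₁, hi₁⟩ : ∃ i, e i < 0 := by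
      by_contra! hnn
      have h1 := hφL _ heL
      simp only [map_sum, map_smul, smul_eq_mul] at h1
      rw [Finset.sum_eq_zero_iff_of_nonneg (fun i _ => by
        by_cases hi : i ∈ s
        · exact mul_nonneg (hnn i) (hφJ i (hsJ i hi)).le
        · simp [hes i hi])] at h1
      have hjs : j ∈ s := by
        by_contra hjs
        exact hj (hes j hjs)
      rcases mul_eq_zero.mp (h1 j (Finset.mem_univ j)) with h2 | h2
      · exact hj h2
      · exact (hφJ j (hsJ j hjs)).ne' h2
    obtain ⟨i₀, hi₀, hmin⟩ := (Finset.univ.filter fun i => e i < 0).exists_min_image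
      (fun i => r i / (-e i)) ⟨i₁, by simpa using hi₁⟩
    have hei₀ : e i₀ < 0 := (Finset.mem_filter.mp hi₀).2
    set q := r i₀ / (-e i₀) with hq
    have hq0 : 0 ≤ q := div_nonneg (hr.1 i₀) (by linarith)
    have hr₂ : r + q • e ∈ X := by
      refine ⟨fun i => ?_, fun i hi => ?_, ?_⟩
      · simp only [Pi.zero_apply, Pi.add_apply, Pi.smul_apply, smul_eq_mul]
        rcases le_or_gt 0 (e i) with h0 | h0
        · exact add_nonneg (hr.1 i) (mul_nonneg hq0 h0)
        · have h1 := hmin i (by simpa using h0)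
          rw [le_div_iff₀ (by linarith)] at h1
          linarith
      · have : i ∉ s := fun his => hi (hsJ i his)
        simp [hr.2.1 i hi, hes i this]
      · have h1 : w - ∑ i, (r + q • e) i • a i = (w - ∑ i, r i • a i) - q • ∑ i, e i • a i := by
          simp only [Pi.add_apply, Pi.smul_apply, add_smul, Finset.sum_add_distrib,
            Finset.smul_sum, smul_eq_mul, mul_smul]
          abel
        rw [h1]
        exact L.sub_mem hr.2.2 (L.smul_mem _ heL)
    refine ih _ ?_ (r + q • e) hr₂ (fun r' hr' => ?_) rfl
    · rw [← hn]
      refine Finset.card_lt_card ((Finset.ssubset_iff_of_subset fun i hi => ?_).mpr ⟨i₀, ?_, ?_⟩)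
      · by_contra his
        have h1 : r i = 0 := by simpa [hs] using his
        exact (Finset.mem_filter.mp hi).2 (by simp [h1, hes i his])
      · by_contra his
        exact hei₀.ne (hes i₀ his)
      · have : r i₀ + q * e i₀ = 0 := by
          rw [hq, div_neg, neg_mul, div_mul_cancel₀ _ hei₀.ne, add_neg_cancel]
        simp [this]
    · refine le_trans (b := ∑ i, r i) (hmax hr') ?_
      change ∑ i, r i ≤ ∑ i, (r i + q * e i)
      rw [Finset.sum_add_distrib, ← Finset.mul_sum]
      exact le_add_of_nonneg_right (mul_nonneg hq0 hepos)
  obtain ⟨r, hr, hmax, hcard⟩ := key _ r₁ hr₁ hmax₁ rfl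
  exact ⟨r, hr.1, hr.2.1, hr.2.2, fun r' h0 hJ hL => hmax (a := r') ⟨h0, hJ, hL⟩, hcard⟩

/-! ### Tight cones and implicit equations. -/

/-- The cone of the rows of `A` whose inequality in `A x ≥ b` is tight at `x`. -/
def tightCone {ι S : Type*} [Fintype ι] [Fintype S] (A : Matrix ι S ℝ) (b : ι → ℝ)
    (x : S → ℝ) : Set (S → ℝ) :=
  {w | ∃ y : ι → ℝ, 0 ≤ y ∧ (∀ i, y i ≠ 0 → (A *ᵥ x) i = b i) ∧ y ᵥ* A = w}

section tightCone

variable {ι S : Type*} [Fintype ι] [Fintype S] {A : Matrix ι S ℝ} {b : ι → ℝ} {x : S → ℝ}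

theorem zero_mem_tightCone : 0 ∈ tightCone A b x :=
  ⟨0, le_rfl, fun _ hi => absurd rfl hi, zero_vecMul A⟩

theorem add_mem_tightCone {v w : S → ℝ} (hv : v ∈ tightCone A b x) (hw : w ∈ tightCone A b x) :
    v + w ∈ tightCone A b x := by
  obtain ⟨y, hy, hys, rfl⟩ := hv
  obtain ⟨y', hy', hys', rfl⟩ := hw
  refine ⟨y + y', add_nonneg hy hy', fun i hi => ?_, add_vecMul _ _ _⟩
  by_cases h : y i = 0
  · exact hys' i fun h' => hi (by simp [h, h'])
  · exact hys i h

theorem smul_mem_tightCone {v : S → ℝ} (hv : v ∈ tightCone A b x) {r : ℝ} (hr : 0 ≤ r) :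
    r • v ∈ tightCone A b x := by
  obtain ⟨y, hy, hys, rfl⟩ := hv
  refine ⟨r • y, smul_nonneg hr hy, fun i hi => hys i fun h => hi (by simp [h]), ?_⟩
  rw [smul_vecMul]

theorem row_mem_tightCone {i : ι} (hi : (A *ᵥ x) i = b i) : A i ∈ tightCone A b x := by
  classical
  refine ⟨Pi.single i 1, Pi.single_nonneg.mpr zero_le_one, fun j hj => ?_,
    single_one_vecMul i A⟩
  rcases eq_or_ne j i with rfl | hji
  · exact hi
  · simp [hji] at hj

theorem sum_mem_tightCone {r : ι → ℝ} (hr : 0 ≤ r)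
    (hrs : ∀ i, r i ≠ 0 → (A *ᵥ x) i = b i) : ∑ i, r i • A i ∈ tightCone A b x :=
  ⟨r, hr, hrs, vecMul_eq_sum r A⟩

/-- The span of the implicit equations is part of the cone of the tight rows. -/
theorem span_implicitEquations_subset_tightCone (hx : x ∈ polyhedron A b) {v : S → ℝ}
    (hv : v ∈ Submodule.span ℝ (A '' implicitEquations A b)) : v ∈ tightCone A b x := by
  classical
  -- Closure under negative scalars needs both signs in the induction.
  suffices v ∈ tightCone A b x ∧ -v ∈ tightCone A b x from this.1
  induction hv using Submodule.span_induction with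
  | mem v hv =>
    obtain ⟨j, hj, rfl⟩ := hv
    refine ⟨row_mem_tightCone (hj.2 x hx), ?_⟩
    -- A direction nonnegative on all tight rows keeps `x` feasible for a short time, so the
    -- implicit equation `j` is constant along it.
    obtain ⟨y, hy0, hyt, hy⟩ := farkas_finset
      (Finset.univ.filter fun i => (A *ᵥ x) i = b i) A (-A j) (by
        intro v hv
        obtain ⟨ε, hε, hε0⟩ := ((eventually_add_smul_mem_polyhedron hx (v := v) fun i hi =>
          hv i (by simpa using hi)).and self_mem_nhdsWithin).exists
        have h1 := hj.2 _ hε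
        rw [mulVec_add, mulVec_smul, Pi.add_apply, hj.2 x hx, add_eq_left, Pi.smul_apply,
          smul_eq_mul] at h1
        rw [neg_dotProduct, neg_nonneg]
        exact ((mul_eq_zero.mp h1).resolve_left (ne_of_gt hε0)).le)
    have hyt' : ∀ i, y i ≠ 0 → (A *ᵥ x) i = b i := fun i hi => by
      by_contra h
      exact hi (hyt i (by simpa using h))
    have hsum : ∑ i, y i • A i = -A j := by
      rw [← hy]
      refine (Finset.sum_subset (Finset.filter_subset _ _) fun i _ hi => ?_).symm
      rw [hyt i hi, zero_smul]
    rw [← hsum]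
    exact sum_mem_tightCone hy0 hyt'
  | zero => exact ⟨zero_mem_tightCone, by simpa using zero_mem_tightCone⟩
  | add v w _ _ hv hw =>
    refine ⟨add_mem_tightCone hv.1 hw.1, ?_⟩
    rw [neg_add]
    exact add_mem_tightCone hv.2 hw.2
  | smul r v _ hv =>
    rcases le_total 0 r with hr | hr
    · refine ⟨smul_mem_tightCone hv.1 hr, ?_⟩
      rw [← smul_neg]
      exact smul_mem_tightCone hv.2 hr
    · have hr' : 0 ≤ -r := neg_nonneg.mpr hr
      refine ⟨?_, ?_⟩
      · rw [← neg_smul_neg]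
        exact smul_mem_tightCone hv.2 hr'
      · rw [← neg_smul]
        exact smul_mem_tightCone hv.1 hr'

/-- A direction in the lineality space of the tight cone at `x` along which every tight inequality
that is not an implicit equation becomes strict. -/
theorem exists_direction_implicitEquations (hx : x ∈ polyhedron A b) :
    ∃ v : S → ℝ, (∀ i ∈ implicitEquations A b, (A *ᵥ v) i = 0) ∧
      ∀ i, (A *ᵥ x) i = b i → A i ≠ 0 → i ∉ implicitEquations A b → 0 < (A *ᵥ v) i := by
  -- One feasible witness of strictness per row; the sum of their displacements from `x` is strict
  -- for all these rows at once.
  have h : ∀ i, ∃ x' ∈ polyhedron A b, (A *ᵥ x) i = b i → A i ≠ 0 →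
      i ∉ implicitEquations A b → b i < (A *ᵥ x') i := by
    intro i
    by_cases hi : A i ≠ 0 ∧ i ∉ implicitEquations A b
    · obtain ⟨x', hx', hne⟩ : ∃ x' ∈ polyhedron A b, (A *ᵥ x') i ≠ b i := by
        by_contra! hcon
        exact hi.2 ⟨hi.1, hcon⟩
      exact ⟨x', hx', fun _ _ _ => lt_of_le_of_ne (hx' i) hne.symm⟩
    · exact ⟨x, hx, fun _ h1 h2 => absurd ⟨h1, h2⟩ hi⟩
  choose x' hx' hlt using h
  have hsum : ∀ i, (A *ᵥ ∑ j, (x' j - x)) i = ∑ j, ((A *ᵥ x' j) i - (A *ᵥ x) i) := by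
    intro i
    simp only [mulVec_sum, Finset.sum_apply, mulVec_sub, Pi.sub_apply]
  refine ⟨∑ j, (x' j - x), fun i hi => ?_, fun i hi hAi hiE => ?_⟩
  · rw [hsum]
    exact Finset.sum_eq_zero fun j _ => by rw [hi.2 _ (hx' j), hi.2 x hx, sub_self]
  · rw [hsum]
    refine Finset.sum_pos' (fun j _ => ?_) ⟨i, Finset.mem_univ i, ?_⟩
    · rw [hi]
      exact sub_nonneg.mpr (hx' j i)
    · rw [hi]
      exact sub_pos.mpr (hlt i hi hAi hiE)

end tightCone

/-- Integral Carathéodory property of the tight cones of an integral box-TDI system. -/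
theorem IsBoxTDI.exists_integral_card_le {ι S : Type*} [Fintype ι] [Fintype S] [DecidableEq S]
    {Q : Matrix ι S ℤ} {b : ι → ℝ} (h : IsBoxTDI (Q.map fun k : ℤ => (k : ℝ)) b) {z : S → ℤ}
    (hz : (fun s => (z s : ℝ)) ∈ polyhedron (Q.map fun k : ℤ => (k : ℝ)) b)
    (hE : (implicitEquations (Q.map fun k : ℤ => (k : ℝ)) b).ncard ≤ 2 * Module.finrank ℝ
      (Submodule.span ℝ ((Q.map fun k : ℤ => (k : ℝ)) ''
        implicitEquations (Q.map fun k : ℤ => (k : ℝ)) b)))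
    {y : ι → ℤ} (hy0 : 0 ≤ y)
    (hslack : ∀ i, y i ≠ 0 → ((Q.map fun k : ℤ => (k : ℝ)) *ᵥ fun s => (z s : ℝ)) i = b i) :
    ∃ y' : ι → ℤ, 0 ≤ y' ∧
      (∀ i, y' i ≠ 0 → ((Q.map fun k : ℤ => (k : ℝ)) *ᵥ fun s => (z s : ℝ)) i = b i) ∧
      y' ᵥ* Q = y ᵥ* Q ∧ (Finset.univ.filter fun i => 0 < y' i).card ≤ 2 * Fintype.card S := by
  classical
  set A : Matrix ι S ℝ := Q.map fun k : ℤ => (k : ℝ) with hA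
  set x : S → ℝ := fun s => (z s : ℝ) with hx
  set E := implicitEquations A b with hEdef
  set L := Submodule.span ℝ (A '' E) with hL
  set J : Set ι := {i | (A *ᵥ x) i = b i ∧ A i ≠ 0 ∧ i ∉ E} with hJ
  obtain ⟨v, hvE, hvJ⟩ := exists_direction_implicitEquations hz
  have hoffJ : ∀ i, (A *ᵥ x) i = b i → i ∉ J → A i ∈ L := by
    intro i hi hiJ
    by_cases h0 : A i = 0
    · rw [h0]
      exact L.zero_mem
    · have : i ∈ E := by
        by_contra hiE
        exact hiJ ⟨hi, h0, hiE⟩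
      exact Submodule.subset_span ⟨i, this, rfl⟩
  have hrestrict : ∀ y : ι → ℤ, (∀ i, y i ≠ 0 → (A *ᵥ x) i = b i) →
      ((fun i => (y i : ℝ)) ᵥ* A) - ∑ i, (if i ∈ J then (y i : ℝ) else 0) • A i ∈ L := by
    intro y hy
    rw [vecMul_eq_sum, ← Finset.sum_sub_distrib]
    refine L.sum_mem fun i _ => ?_
    split_ifs with hi
    · simp
    · rw [zero_smul, sub_zero]
      by_cases hyi : y i = 0
      · simp [hyi]
      · exact L.smul_mem _ (hoffJ i (hy i hyi) hi)
  set w : S → ℝ := (fun i => (y i : ℝ)) ᵥ* A with hw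
  have hrest0 : ∀ y : ι → ℤ, 0 ≤ y → 0 ≤ fun i => if i ∈ J then (y i : ℝ) else 0 := by
    intro y hy i
    change (0 : ℝ) ≤ if i ∈ J then (y i : ℝ) else 0
    split_ifs
    · exact_mod_cast hy i
    · exact le_rfl
  obtain ⟨r, hr0, hrJ, hrL, hrmax, hrcard⟩ := exists_isMaxOn_sum_card_le_codim L A J w
    { toFun := fun u => u ⬝ᵥ v
      map_add' := fun u u' => add_dotProduct u u' v
      map_smul' := fun c u => smul_dotProduct c u v }
    (by
      intro u hu
      induction hu using Submodule.span_induction with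
      | mem u hu =>
        obtain ⟨i, hi, rfl⟩ := hu
        exact hvE i hi
      | zero => exact zero_dotProduct v
      | add u u' _ _ hu hu' => rw [map_add, hu, hu', add_zero]
      | smul c u _ hu => rw [map_smul, hu, smul_zero])
    (fun i hi => hvJ i hi.1 hi.2.1 hi.2.2) (hrest0 y hy0) (fun i hi => if_neg hi)
    (hrestrict y hslack)
  -- The remainder is a vector of `L` plus the fractional parts, both in the tight cone. It is also
  -- integral, so it has an integral representation `m`.
  have hfr : w - (∑ i, (⌊r i⌋ : ℝ) • A i) ∈ tightCone A b x := by
    have h1 : w - (∑ i, (⌊r i⌋ : ℝ) • A i) =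
        (w - ∑ i, r i • A i) + ∑ i, Int.fract (r i) • A i := by
      simp only [Int.fract, sub_smul, Finset.sum_sub_distrib]
      abel
    rw [h1]
    refine add_mem_tightCone (span_implicitEquations_subset_tightCone hz hrL)
      (sum_mem_tightCone (fun i => Int.fract_nonneg _) fun i hi => ?_)
    by_contra hti
    exact hi (by simp [hrJ i fun hiJ => hti hiJ.1])
  obtain ⟨y₁, hy₁0, hy₁s, hy₁⟩ := hfr
  have hy₁int : ∀ s ∉ (∅ : Finset S), (y₁ ᵥ* A) s = (((y - fun i => ⌊r i⌋) ᵥ* Q) s : ℤ) := by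
    intro s _
    rw [hy₁, ← vecMul_map_intCast, hw, ← vecMul_eq_sum, ← sub_vecMul]
    congr 2
    ext i
    simp
  obtain ⟨m, hm0, hms, hmQ⟩ := h.exists_integral_coord hz ∅ hy₁0 hy₁s hy₁int
  have hfl0 : ∀ i, 0 ≤ ⌊r i⌋ := fun i => Int.floor_nonneg.mpr (hr0 i)
  have hfls : ∀ i, ⌊r i⌋ ≠ 0 → i ∈ J := fun i hi => by
    by_contra hiJ
    exact hi (by simp [hrJ i hiJ])
  have hsumQ : (m + fun i => ⌊r i⌋) ᵥ* Q = y ᵥ* Q := by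
    ext s
    have h1 := hmQ s (Finset.notMem_empty s)
    rw [vecMul_map_intCast, Int.cast_inj, sub_vecMul, Pi.sub_apply] at h1
    rw [add_vecMul, Pi.add_apply, h1, sub_add_cancel]
  have hsums : ∀ i, (m + fun i => ⌊r i⌋) i ≠ 0 → (A *ᵥ x) i = b i := by
    intro i hi
    by_cases hmi : m i = 0
    · exact (hfls i (by simpa [hmi] using hi)).1
    · exact hms i hmi
  have hsum0 : 0 ≤ m + fun i => ⌊r i⌋ := fun i => add_nonneg (hm0 i) (hfl0 i)
  have hQA : ∀ i, A i = 0 → Q i = 0 := fun i hi => by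
    ext s
    have := congrFun hi s
    simpa [hA] using this
  -- Zero rows belong neither to `E` nor to `J`; dropping them leaves the combination unchanged.
  refine ⟨fun i => if A i = 0 then 0 else (m + fun i => ⌊r i⌋) i, fun i => ?_, fun i hi => ?_,
    ?_, ?_⟩
  · change (0 : ℤ) ≤ if A i = 0 then 0 else _
    split_ifs
    · exact le_rfl
    · exact hsum0 i
  · refine hsums i ?_
    beta_reduce at hi
    split_ifs at hi
    · exact absurd rfl hi
    · exact hi
  · rw [← hsumQ, vecMul_eq_sum, vecMul_eq_sum]
    refine Finset.sum_congr rfl fun i _ => ?_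
    split_ifs with h0
    · rw [hQA i h0, smul_zero, smul_zero]
    · rfl
  · beta_reduce
    -- `m + ⌊r⌋` competes with `r`, so on `J` the sum of `m` is at most the sum of the fractional
    -- parts of `r`.
    have hmJ : ∑ i, (if i ∈ J then (m i : ℝ) else 0) ≤ (Finset.univ.filter fun i => r i ≠ 0).card := by
      have h1 := hrmax _ (hrest0 _ hsum0) (fun i hi => if_neg hi) (by
        have h2 := hrestrict _ hsums
        convert h2 using 2
        ext s
        rw [hw, vecMul_map_intCast, vecMul_map_intCast, hsumQ])
      have h2 : ∀ i, (if i ∈ J then (((m + fun i => ⌊r i⌋) i : ℤ) : ℝ) else 0) =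
          (if i ∈ J then (m i : ℝ) else 0) + (r i - Int.fract (r i)) := by
        intro i
        rw [Int.self_sub_fract]
        split_ifs with hi
        · simp
        · simp [hrJ i hi]
      simp only [h2, Finset.sum_add_distrib, Finset.sum_sub_distrib] at h1
      have h3 : ∑ i, Int.fract (r i) ≤ (Finset.univ.filter fun i => r i ≠ 0).card := by
        rw [← Finset.sum_filter_of_ne (p := fun i => r i ≠ 0)
          (fun i _ hi h0 => hi (by simp [h0])), Finset.cast_card]
        exact Finset.sum_le_sum fun i _ => (Int.fract_lt_one _).le
      linarith
    have hcardm : (Finset.univ.filter fun i => i ∈ J ∧ 0 < m i).card ≤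
        (Finset.univ.filter fun i => r i ≠ 0).card := by
      have h1 : ((Finset.univ.filter fun i => i ∈ J ∧ 0 < m i).card : ℝ) ≤
          ∑ i, (if i ∈ J then (m i : ℝ) else 0) := by
        rw [Finset.card_filter, Nat.cast_sum]
        refine Finset.sum_le_sum fun i _ => ?_
        by_cases hi : i ∈ J
        · by_cases hm : 0 < m i
          · have : (1 : ℝ) ≤ m i := by exact_mod_cast hm
            simpa [hi, hm] using this
          · have : (0 : ℝ) ≤ m i := by exact_mod_cast hm0 i
            simpa [hi, hm] using this
        · simp [hi]
      exact_mod_cast h1.trans hmJ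
    have hsub : (Finset.univ.filter fun i =>
        0 < (if A i = 0 then 0 else (m + fun i => ⌊r i⌋) i : ℤ)) ⊆
        (Finset.univ.filter fun i => i ∈ E) ∪ ((Finset.univ.filter fun i => r i ≠ 0) ∪
          Finset.univ.filter fun i => i ∈ J ∧ 0 < m i) := by
      intro i hi
      have hi := (Finset.mem_filter.mp hi).2
      simp only [Finset.mem_union, Finset.mem_filter, Finset.mem_univ, true_and]
      split_ifs at hi with hAi
      · exact absurd hi (lt_irrefl _)
      by_cases hiE : i ∈ E
      · exact Or.inl hiE
      by_cases hri : r i = 0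
      · refine Or.inr (Or.inr ⟨⟨hsums i hi.ne', hAi, hiE⟩, ?_⟩)
        simpa [hri] using hi
      · exact Or.inr (Or.inl hri)
    have hEcard : (Finset.univ.filter fun i => i ∈ E).card = E.ncard := by
      rw [← Set.ncard_coe_finset]
      simp
    have h1 := Finset.card_le_card hsub
    have h2 := Finset.card_union_le (Finset.univ.filter fun i => i ∈ E)
      ((Finset.univ.filter fun i => r i ≠ 0) ∪ Finset.univ.filter fun i => i ∈ J ∧ 0 < m i)
    have h3 := Finset.card_union_le (Finset.univ.filter fun i => r i ≠ 0)
      (Finset.univ.filter fun i => i ∈ J ∧ 0 < m i)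
    have h4 := Submodule.finrank_quotient_add_finrank L
    rw [Module.finrank_fintype_fun_eq_card] at h4
    omega

/-! ### The quadratic objective and its dual. -/

/-- The floor is `w / (2c)` rounded to a nearest integer, which amounts to `|w - 2ck| ≤ c`. -/
theorem floor_bounds {c : ℤ} (hc : 0 < c) (w : ℤ) :
    c * (2 * ⌊((w + c : ℤ) : ℝ) / (2 * (c : ℝ))⌋ - 1) ≤ w ∧
      w ≤ c * (2 * ⌊((w + c : ℤ) : ℝ) / (2 * (c : ℝ))⌋ + 1) := by
  have hc' : (0 : ℝ) < 2 * c := by exact_mod_cast (by linarith : 0 < 2 * c)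
  set k := ⌊((w + c : ℤ) : ℝ) / (2 * (c : ℝ))⌋ with hk
  have h1 : (k : ℝ) * (2 * c) ≤ ((w + c : ℤ) : ℝ) := (le_div_iff₀ hc').mp (Int.floor_le _)
  have h2 : ((w + c : ℤ) : ℝ) < (k + 1) * (2 * c) := (div_lt_iff₀ hc').mp (Int.lt_floor_add_one _)
  have h1' : k * (2 * c) ≤ w + c := by exact_mod_cast h1
  have h2' : w + c < (k + 1) * (2 * c) := by exact_mod_cast h2
  constructor <;> linarith

/-- The integers nearest to `w / (2 c)` maximize `k (w - c k)`. -/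
theorem mul_sub_le_of_bounds {c k w : ℤ} (hc : 0 < c) (hl : c * (2 * k - 1) ≤ w)
    (hu : w ≤ c * (2 * k + 1)) (z : ℤ) : z * (w - c * z) ≤ k * (w - c * k) := by
  -- This product is the difference of the two sides. Integrality enters through `z ≤ k - 1` or `z ≥
  -- k + 1` for `z ≠ k`.
  have hprod : 0 ≤ (z - k) * (c * (z + k) - w) := by
    rcases lt_trichotomy z k with h | rfl | h
    · refine mul_nonneg_of_nonpos_of_nonpos (by linarith) ?_
      have : c * (z + k) ≤ c * (2 * k - 1) := mul_le_mul_of_nonneg_left (by omega) hc.le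
      linarith
    · simp
    · refine mul_nonneg (by linarith) ?_
      have : c * (2 * k + 1) ≤ c * (z + k) := mul_le_mul_of_nonneg_left (by omega) hc.le
      linarith
  linarith

theorem mem_integralPoints_iff {ι S : Type*} [Fintype S] {Q : Matrix ι S ℤ} {p : ι → ℤ}
    {z : S → ℤ} : z ∈ integralPoints (polyhedron (Q.map fun k : ℤ => (k : ℝ))
      fun i => (p i : ℝ)) ↔ p ≤ Q *ᵥ z := by
  refine forall_congr' fun i => ?_
  rw [← Int.cast_le (R := ℝ)]
  simp [mulVec, dotProduct]

theorem mulVec_map_intCast {ι S : Type*} [Fintype S] (Q : Matrix ι S ℤ) (z : S → ℤ) (i : ι) :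
    ((Q.map fun k : ℤ => (k : ℝ)) *ᵥ fun s => (z s : ℝ)) i = ((Q *ᵥ z) i : ℤ) := by
  simp [mulVec, dotProduct]

section duality

variable {ι S : Type*} [Fintype ι] [Fintype S] {Q : Matrix ι S ℤ} {p : ι → ℤ} {c : S → ℤ}

theorem dotProduct_eq_sub_slack (Q : Matrix ι S ℤ) (p y : ι → ℤ) (z : S → ℤ) :
    y ⬝ᵥ p = (y ᵥ* Q) ⬝ᵥ z - y ⬝ᵥ (Q *ᵥ z - p) := by
  rw [dotProduct_sub, dotProduct_mulVec]
  ring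

theorem slack_nonneg {y : ι → ℤ} (hy : 0 ≤ y) {z : S → ℤ} (hz : p ≤ Q *ᵥ z) :
    0 ≤ y ⬝ᵥ (Q *ᵥ z - p) :=
  Finset.sum_nonneg fun i _ => mul_nonneg (hy i) (sub_nonneg.mpr (hz i))

theorem dotProduct_sub_weightedSquareSum (w z : S → ℤ) :
    w ⬝ᵥ z - weightedSquareSum c z = ∑ s, z s * (w s - c s * z s) := by
  rw [dotProduct, weightedSquareSum, ← Finset.sum_sub_distrib]
  exact Finset.sum_congr rfl fun s _ => by ring

/-- Weak duality. -/
theorem dualObjective_le_weightedSquareSum (hc : ∀ s, 0 < c s) {y : ι → ℤ} (hy : 0 ≤ y)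
    {z : S → ℤ} (hz : p ≤ Q *ᵥ z) : dualObjective Q p c y ≤ weightedSquareSum c z := by
  have h1 := slack_nonneg hy hz
  have h2 := dotProduct_sub_weightedSquareSum (c := c) (y ᵥ* Q) z
  have h3 := Finset.sum_le_sum fun s (_ : s ∈ Finset.univ) =>
    mul_sub_le_of_bounds (hc s) (floor_bounds (hc s) ((y ᵥ* Q) s)).1
      (floor_bounds (hc s) ((y ᵥ* Q) s)).2 (z s)
  rw [dualObjective, dotProduct_eq_sub_slack Q p y z]
  linarith

/-- The optimality criterion makes the two objectives equal. -/
theorem dualObjective_eq_weightedSquareSum (hc : ∀ s, 0 < c s) {y : ι → ℤ} {z : S → ℤ}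
    (hyz : y ⬝ᵥ (Q *ᵥ z - p) = 0)
    (hw : ∀ s, c s * (2 * z s - 1) ≤ (y ᵥ* Q) s ∧ (y ᵥ* Q) s ≤ c s * (2 * z s + 1)) :
    dualObjective Q p c y = weightedSquareSum c z := by
  have h2 := dotProduct_sub_weightedSquareSum (c := c) (y ᵥ* Q) z
  -- Both the floor and `z s` maximize the same function, so their values agree even in case of a
  -- tie.
  have h3 := Finset.sum_congr rfl fun s (_ : s ∈ Finset.univ) =>
    le_antisymm (mul_sub_le_of_bounds (hc s) (hw s).1 (hw s).2 _)
      (mul_sub_le_of_bounds (hc s) (floor_bounds (hc s) ((y ᵥ* Q) s)).1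
        (floor_bounds (hc s) ((y ᵥ* Q) s)).2 (z s))
  rw [dualObjective, dotProduct_eq_sub_slack Q p y z, h3, hyz]
  linarith

theorem slack_eq_zero_iff {y : ι → ℤ} (hy : 0 ≤ y) {z : S → ℤ} (hz : p ≤ Q *ᵥ z) :
    y ⬝ᵥ (Q *ᵥ z - p) = 0 ↔
      ∀ i, y i ≠ 0 → ((Q.map fun k : ℤ => (k : ℝ)) *ᵥ fun s => (z s : ℝ)) i = p i := by
  have hnn : ∀ i ∈ Finset.univ, 0 ≤ y i * (Q *ᵥ z - p) i :=
    fun i _ => mul_nonneg (hy i) (sub_nonneg.mpr (hz i))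
  rw [dotProduct, Finset.sum_eq_zero_iff_of_nonneg hnn]
  simp only [Finset.mem_univ, true_imp_iff, mul_eq_zero, Pi.sub_apply, sub_eq_zero,
    mulVec_map_intCast, Int.cast_inj, or_iff_not_imp_left, ne_eq]

end duality

/-- The separable quadratic objective attains its minimum over a nonempty set of integral
vectors. -/
theorem exists_isMinOn_weightedSquareSum {S : Type*} [Fintype S] {c : S → ℤ}
    (hc : ∀ s, 0 < c s) {Z : Set (S → ℤ)} (hZ : Z.Nonempty) :
    ∃ z ∈ Z, IsMinOn (weightedSquareSum c) Z z := by
  have h0 : ∀ z, 0 ≤ weightedSquareSum c z := fun z =>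
    Finset.sum_nonneg fun s _ => mul_nonneg (hc s).le (sq_nonneg _)
  obtain ⟨_, ⟨z, hz, rfl⟩, hmin⟩ := Int.exists_least_of_bdd
    (P := fun n => ∃ z ∈ Z, weightedSquareSum c z = n)
    ⟨0, by rintro _ ⟨z, _, rfl⟩; exact h0 z⟩ (by
      obtain ⟨z, hz⟩ := hZ
      exact ⟨_, z, hz, rfl⟩)
  exact ⟨z, hz, fun z' hz' => hmin _ ⟨z', hz', rfl⟩⟩

end BoxTDI

/-! ### The min-max theorem. -/

theorem theorem5p3 {ι S : Type*} [Fintype ι] [Fintype S] [DecidableEq S]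
    (Q : Matrix ι S ℤ) (p : ι → ℤ) (c : S → ℤ) (hc : ∀ s, 0 < c s)
    (A : Matrix ι S ℝ) (hA : A = Q.map (fun k : ℤ => (k : ℝ)))
    (b : ι → ℝ) (hb : b = fun i => (p i : ℝ))
    (R : Set (S → ℝ)) (hR : R = BoxTDI.polyhedron A b)
    (hbox : BoxTDI.IsBoxTDI A b) (hne : R.Nonempty) :
    -- the min-max formula, both optima being attained
    (∃ M : ℤ,
      IsLeast (BoxTDI.weightedSquareSum c '' BoxTDI.integralPoints R) M ∧
      IsGreatest (BoxTDI.dualObjective Q p c '' {y : ι → ℤ | 0 ≤ y}) M) ∧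
    -- the optimality criteria
    (∀ z ∈ BoxTDI.integralPoints R,
      IsMinOn (BoxTDI.weightedSquareSum c) (BoxTDI.integralPoints R) z ↔
        ∃ y : ι → ℤ, 0 ≤ y ∧ y ⬝ᵥ (Q *ᵥ z - p) = 0 ∧
          ∀ s, c s * (2 * z s - 1) ≤ (y ᵥ* Q) s ∧ (y ᵥ* Q) s ≤ c s * (2 * z s + 1)) ∧
    -- an optimal dual solution with few positive components
    ((BoxTDI.implicitEquations A b).ncard ≤
        2 * Module.finrank ℝ (Submodule.span ℝ (A '' BoxTDI.implicitEquations A b)) →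
      ∃ y : ι → ℤ, 0 ≤ y ∧
        IsMaxOn (BoxTDI.dualObjective Q p c) {y : ι → ℤ | 0 ≤ y} y ∧
        (Finset.univ.filter fun i => 0 < y i).card ≤ 2 * Fintype.card S) := by
  subst hA hb hR
  obtain ⟨x, hx⟩ := hne
  -- With zero objective this only yields an integral feasible point near `x`.
  obtain ⟨z₀, hz₀, -⟩ := hbox.exists_integral_point (f₀ := fun s => ⌊x s⌋) (g₀ := fun s => ⌈x s⌉)
    0 hx (fun s => Int.floor_le _) fun s => Int.le_ceil _
  obtain ⟨z, hz, hzmin⟩ := BoxTDI.exists_isMinOn_weightedSquareSum hc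
    (Z := BoxTDI.integralPoints (BoxTDI.polyhedron (Q.map fun k : ℤ => (k : ℝ))
      fun i => (p i : ℝ))) ⟨z₀, hz₀⟩
  have hz' := BoxTDI.mem_integralPoints_iff.mp hz
  obtain ⟨y, hy0, hys, hyl, hyu⟩ := hbox.exists_multiplier_of_isMinOn hc hz hzmin
  have heq := BoxTDI.dualObjective_eq_weightedSquareSum hc
    ((BoxTDI.slack_eq_zero_iff hy0 hz').mpr hys) fun s => ⟨hyl s, hyu s⟩
  refine ⟨⟨BoxTDI.weightedSquareSum c z, ⟨⟨z, hz, rfl⟩, ?_⟩, ⟨y, hy0, heq⟩, ?_⟩, ?_, ?_⟩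
  · rintro _ ⟨z', hz', rfl⟩
    exact hzmin hz'
  · rintro _ ⟨y', hy', rfl⟩
    exact BoxTDI.dualObjective_le_weightedSquareSum hc hy' hz'
  · refine fun z₁ hz₁ => ⟨fun hmin => ?_, ?_⟩
    · obtain ⟨y₁, hy₁, hs₁, hl₁, hu₁⟩ := hbox.exists_multiplier_of_isMinOn hc hz₁ hmin
      exact ⟨y₁, hy₁, (BoxTDI.slack_eq_zero_iff hy₁
        (BoxTDI.mem_integralPoints_iff.mp hz₁)).mpr hs₁, fun s => ⟨hl₁ s, hu₁ s⟩⟩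
    · rintro ⟨y₁, hy₁, hs₁, hw₁⟩ z₂ hz₂
      rw [Set.mem_ofPred_eq, ← BoxTDI.dualObjective_eq_weightedSquareSum hc hs₁ hw₁]
      exact BoxTDI.dualObjective_le_weightedSquareSum hc hy₁
        (BoxTDI.mem_integralPoints_iff.mp hz₂)
  · intro hE
    -- The sparse `y₁` has the same `w` as `y` and uses only rows tight at `z`, so it meets the
    -- criterion with `z`.
    obtain ⟨y₁, hy₁, hs₁, hQ₁, hcard⟩ := hbox.exists_integral_card_le hz hE hy0 hys
    refine ⟨y₁, hy₁, fun y₂ hy₂ => ?_, hcard⟩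
    rw [Set.mem_ofPred_eq, BoxTDI.dualObjective_eq_weightedSquareSum hc
      ((BoxTDI.slack_eq_zero_iff hy₁ hz').mpr hs₁) fun s => by
        rw [hQ₁]
        exact ⟨hyl s, hyu s⟩]
    exact BoxTDI.dualObjective_le_weightedSquareSum hc hy₂ hz'
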